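/- \textbf{Setting.} Let $(\Omega,P)$ be a probability space, $n\ge 1$, $W_1,\dots,W_n$ random elements of a measurable space $\mathcal W$ (e.g. $\mathbb R^{d_W}$), $\Theta$ a set, $\Delta$ a measurable space, and $\hat\delta:\Omega\to\Delta$ a random element (the first-stage estimator). Let $M(\cdot,\theta):\mathcal W\to\mathbb R^{d_M}$ and $N(\cdot,\theta,\cdot):\mathcal W\times\Delta\to\mathbb R^{d_N}$ be measurable for each $\theta\in\Theta$, let $B(\theta)\in\mathbb R^{k\times d_M}$, $C(\theta)\in\mathbb R^{k\times d_N}$, $\rho(\theta)\in\mathbb R^k$, $A(\theta)=[B(\theta),-C(\theta)]$, $p(w,\theta,\delta)=(M(w,\theta),N(w,\theta,\delta))$ and $\bar p(\theta,\hat\delta)=n^{-1}\sum_{i=1}^n p(W_i,\theta,\hat\delta)$. Let $\hat\Sigma_n(\theta,\hat\delta)$ be a random $(d_M+d_N)\times(d_M+d_N)$ matrix, and $0<\alpha<1$. \textbf{The RCC test.} Write $\rho_l$ for the entries of $\rho(\theta)$ and $a_l'$ for the rows of $A(\theta)$, and $\|a\|_{\Sigma}=(a'\Sigma a)^{1/2}$.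 Let $$T_n(\theta,\hat\delta)=\min_{\kappa:\,A(\theta)\kappa\le\rho(\theta)} n(\bar p(\theta,\hat\delta)-\kappa)'\hat\Sigma_n(\theta,\hat\delta)^{-1}(\bar p(\theta,\hat\delta)-\kappa),$$ let $\hat\kappa$ be the minimizer, $\hat J=\{l: a_l'\hat\kappa=\rho_l\}$, and $\hat r=\operatorname{rk}(A_{\hat J})$, where $A_{\hat J}$ consists of the rows of $A(\theta)$ with index in $\hat J$. If $\hat r=1$, choose $i\in\hat J$ with $a_i\ne0$, and for each $j\in\{1,\dots,k\}$, $j\ne i$, put $$z_j=\frac{\sqrt n\,\|a_i\|_{\hat\Sigma_n}(\rho_j-a_j'\hat\kappa)}{\|a_i\|_{\hat\Sigma_n}\|a_j\|_{\hat\Sigma_n}-a_i'\hat\Sigma_n a_j}$$ if the denominator is nonzero and $z_j=\infty$ otherwise; let $z=\inf_{j\neq i}z_j$ ($=\infty$ if there is no such $j$) and $\beta_n=2\alpha\Phi(z)$, where $\Phi$ is the standard normal distribution function and $\Phi(\infty)=1$. If $\hat r\ne1$, let $\beta_n=\alpha$. The test is $$\phi_n^{RCC}(\theta,\hat\delta,\alpha)=\mathbf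 1\{T_n(\theta,\hat\delta)>\chi^2_{\hat r,1-\beta_n}\},$$ where $\chi^2_{r,q}=\inf\{x\ge0: P(\chi^2_r\le x)\ge q\}$ ($\chi^2_0$ is the point mass at $0$). \textbf{Theorem (finite-sample validity).} Assume that for every $\theta\in\Theta$: 1. conditionally on $\hat\delta$, $\sqrt n\,(\bar p(\theta,\hat\delta)-E[\bar p(\theta,\hat\delta)\mid\hat\delta])\sim N(0,\Sigma_n(\theta,\hat\delta))$ with $\Sigma_n(\theta,\hat\delta)$ positive definite (for almost every value of $\hat\delta$); 2. $\hat\Sigma_n(\theta,\hat\delta)=\Sigma_n(\theta,\hat\delta)$ almost surely. Then, for every $\theta\in\Theta$, $\phi_n^{RCC}(\theta,\hat\delta,\alpha)$ is integrable and, for almost every value of $\hat\delta$: (a) if the moment inequalities $A(\theta)E[\bar p(\theta,\hat\delta)\mid\hat\delta]\le\rho(\theta)$ hold, then $E[\phi_n^{RCC}(\theta,\hat\delta,\alpha)\mid\hat\delta]\le\alpha$; (b) if $\alpha\le 1/2$, $A(\theta)\ne0$ and $A(\theta)E[\bar p(\theta,\hat\delta)\mid\hat\delta]=\rho(\theta)$,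 then $E[\phi_n^{RCC}(\theta,\hat\delta,\alpha)\mid\hat\delta]=\alpha$. -/

import Mathlib

open MeasureTheory ProbabilityTheory Matrix

noncomputable section

namespace RCC

/-! ### The chi-squared distribution and the standard normal distribution function -/

/-- The `χ²` distribution with `r` degrees of freedom: the law of `‖Z‖²` for a standard Gaussian
vector `Z` in `ℝ^r` (for `r = 0` this is the point mass at `0`). -/
def chiSq (r : ℕ) : Measure ℝ :=
  (stdGaussian (EuclideanSpace ℝ (Fin r))).map (fun z => ‖z‖ ^ 2)

/-- The quantile `χ²_{r,q} = inf {x ≥ 0 : q ≤ P(χ²_r ≤ x)}` for a level `q < 1`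
(it is `0` for `q ≤ 0`). -/
def chiSqQuantile (r : ℕ) (q : ℝ) : ℝ :=
  sInf {x : ℝ | 0 ≤ x ∧ q ≤ (chiSq r).real (Set.Iic x)}

/-- The standard normal distribution function, extended to `[-∞, ∞]`
(so that `Φ(∞) = 1` and `Φ(-∞) = 0`). -/
def stdNormalCDF (z : EReal) : ℝ :=
  (gaussianReal 0 1).real {x : ℝ | (x : EReal) ≤ z}

/-! ### The refined chi-squared test

In this section `A κ ≤ ρ` is a system of `k` linear inequalities, `S` is the (estimated)
variance matrix, `n` is the sample size and `x` is the value of the sample moment. -/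

section Test

variable {k : ℕ} {ι : Type*} [Fintype ι] [DecidableEq ι]

/-- The norm `‖a‖_S = (a' S a)^{1/2}`. -/
def wnorm (S : Matrix ι ι ℝ) (a : ι → ℝ) : ℝ := Real.sqrt (a ⬝ᵥ S *ᵥ a)

/-- The polyhedron `{κ : A κ ≤ ρ}`. -/
def feasible (A : Matrix (Fin k) ι ℝ) (ρ : Fin k → ℝ) : Set (ι → ℝ) :=
  {κ | ∀ l, (A *ᵥ κ) l ≤ ρ l}

/-- The objective `n (x - κ)' S⁻¹ (x - κ)`. -/
def objective (n : ℕ) (S : Matrix ι ι ℝ) (x κ : ι → ℝ) : ℝ :=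
  n * ((x - κ) ⬝ᵥ S⁻¹ *ᵥ (x - κ))

/-- The test statistic `T_n = min_{κ : A κ ≤ ρ} n (x - κ)' S⁻¹ (x - κ)`. -/
def testStat (n : ℕ) (A : Matrix (Fin k) ι ℝ) (ρ : Fin k → ℝ) (S : Matrix ι ι ℝ)
    (x : ι → ℝ) : ℝ :=
  sInf (objective n S x '' feasible A ρ)

open Classical in
/-- The solution `κ̂` of the minimization problem. It exists and is unique as soon as `n > 0`,
`S` is positive definite and the polyhedron is nonempty; otherwise the value is irrelevant. -/
def kappaHat (n : ℕ) (A : Matrix (Fin k) ι ℝ) (ρ : Fin k → ℝ) (S : Matrix ι ι ℝ)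
    (x : ι → ℝ) : ι → ℝ :=
  if h : ∃ κ ∈ feasible A ρ, IsMinOn (objective n S x) (feasible A ρ) κ then h.choose else 0

open Classical in
/-- The set `Ĵ` of (indices of) active inequalities at `κ̂`. -/
def activeSet (n : ℕ) (A : Matrix (Fin k) ι ℝ) (ρ : Fin k → ℝ) (S : Matrix ι ι ℝ)
    (x : ι → ℝ) : Finset (Fin k) :=
  Finset.univ.filter fun l => (A *ᵥ kappaHat n A ρ S x) l = ρ l

/-- The rank of the submatrix `A_J` formed by the rows with index in `J`. -/
def rowRank (A : Matrix (Fin k) ι ℝ) (J : Finset (Fin k)) : ℕ :=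
  (A.submatrix (fun l : J => (l : Fin k)) id).rank

/-- `r̂ = rk(A_Ĵ)`. -/
def rHat (n : ℕ) (A : Matrix (Fin k) ι ℝ) (ρ : Fin k → ℝ) (S : Matrix ι ι ℝ)
    (x : ι → ℝ) : ℕ :=
  rowRank A (activeSet n A ρ S x)

open Classical in
/-- The quantity `z_j`, computed relative to the active inequality with index `i`. -/
def zj (n : ℕ) (A : Matrix (Fin k) ι ℝ) (ρ : Fin k → ℝ) (S : Matrix ι ι ℝ)
    (x : ι → ℝ) (i j : Fin k) : EReal :=
  if wnorm S (A i) * wnorm S (A j) ≠ A i ⬝ᵥ S *ᵥ A j then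
    ((Real.sqrt n * wnorm S (A i) * (ρ j - (A *ᵥ kappaHat n A ρ S x) j) /
      (wnorm S (A i) * wnorm S (A j) - A i ⬝ᵥ S *ᵥ A j) : ℝ) : EReal)
  else ⊤

/-- `z = inf_{j ≠ i} z_j` (equal to `∞` if there is no `j ≠ i`). -/
def zInf (n : ℕ) (A : Matrix (Fin k) ι ℝ) (ρ : Fin k → ℝ) (S : Matrix ι ι ℝ)
    (x : ι → ℝ) (i : Fin k) : EReal :=
  ⨅ j : {j : Fin k // j ≠ i}, zj n A ρ S x i j

open Classical in
/-- `β_n = 2 α Φ(z)` if `r̂ = 1` and `β_n = α` otherwise. If `r̂ = 1`, then `z` is computed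
relative to some active inequality with a nonzero row (there is one, and when `S` is positive
definite all of them give the same `z`). -/
def betaHat (n : ℕ) (A : Matrix (Fin k) ι ℝ) (ρ : Fin k → ℝ) (S : Matrix ι ι ℝ)
    (α : ℝ) (x : ι → ℝ) : ℝ :=
  if rHat n A ρ S x = 1 then
    if h : ∃ i, i ∈ activeSet n A ρ S x ∧ A i ≠ 0 then
      2 * α * stdNormalCDF (zInf n A ρ S x h.choose)
    else α
  else α

open Classical in
/-- The refined chi-squared test `1{T_n > χ²_{r̂, 1 - β_n}}`. -/
def rccTest (n : ℕ) (A : Matrix (Fin k) ι ℝ) (ρ : Fin k → ℝ) (S : Matrix ι ι ℝ)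
    (α : ℝ) (x : ι → ℝ) : ℝ :=
  if chiSqQuantile (rHat n A ρ S x) (1 - betaHat n A ρ S α x) < testStat n A ρ S x
  then 1 else 0

end Test

/-! ### The two-stage procedure -/

section Model

variable {Ω 𝓦 Θ Δ : Type*} {n k dM dN : ℕ}

/-- `A(θ) = [B(θ), -C(θ)]`. -/
def constraintMatrix (B : Θ → Matrix (Fin k) (Fin dM) ℝ) (C : Θ → Matrix (Fin k) (Fin dN) ℝ)
    (θ : Θ) : Matrix (Fin k) (Fin dM ⊕ Fin dN) ℝ :=
  Matrix.fromCols (B θ) (-(C θ))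

/-- The stacked moment function `p(w, θ, δ) = (M(w, θ), N(w, θ, δ))`. -/
def momentFun (M : 𝓦 → Θ → EuclideanSpace ℝ (Fin dM))
    (N : 𝓦 → Θ → Δ → EuclideanSpace ℝ (Fin dN)) (w : 𝓦) (θ : Θ) (d : Δ) :
    EuclideanSpace ℝ (Fin dM ⊕ Fin dN) :=
  WithLp.toLp 2 (Sum.elim (fun a => M w θ a) (fun b => N w θ d b))

/-- The sample mean at the first-stage estimate, `p̄_n(θ, δ̂) = n⁻¹ ∑_i p(W_i, θ, δ̂)`, as a random
vector. -/
def pbar (M : 𝓦 → Θ → EuclideanSpace ℝ (Fin dM))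
    (N : 𝓦 → Θ → Δ → EuclideanSpace ℝ (Fin dN)) (W : Fin n → Ω → 𝓦) (δhat : Ω → Δ) (θ : Θ)
    (ω : Ω) : EuclideanSpace ℝ (Fin dM ⊕ Fin dN) :=
  (n : ℝ)⁻¹ • ∑ i, momentFun M N (W i ω) θ (δhat ω)

/-- The conditional mean `E[p̄_n(θ, δ̂) | δ̂ = d]`, the mean of the regular conditional distribution
of `p̄_n(θ, δ̂)` given `δ̂ = d`. -/
def condMean [MeasurableSpace Ω] [MeasurableSpace Δ] (P : Measure Ω) [IsFiniteMeasure P]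
    (M : 𝓦 → Θ → EuclideanSpace ℝ (Fin dM))
    (N : 𝓦 → Θ → Δ → EuclideanSpace ℝ (Fin dN)) (W : Fin n → Ω → 𝓦) (δhat : Ω → Δ) (θ : Θ)
    (d : Δ) : EuclideanSpace ℝ (Fin dM ⊕ Fin dN) :=
  ∫ x, x ∂(condDistrib (pbar M N W δhat θ) δhat P d)

/-- The test `φ_n^{RCC}(θ, δ̂, α)` as a random variable. -/
def phiRCC (B : Θ → Matrix (Fin k) (Fin dM) ℝ) (C : Θ → Matrix (Fin k) (Fin dN) ℝ)
    (ρ : Θ → Fin k → ℝ) (M : 𝓦 → Θ → EuclideanSpace ℝ (Fin dM))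
    (N : 𝓦 → Θ → Δ → EuclideanSpace ℝ (Fin dN)) (W : Fin n → Ω → 𝓦) (δhat : Ω → Δ)
    (Sigmahat : Θ → Δ → Ω → Matrix (Fin dM ⊕ Fin dN) (Fin dM ⊕ Fin dN) ℝ) (α : ℝ) (θ : Θ)
    (ω : Ω) : ℝ :=
  rccTest n (constraintMatrix B C θ) (ρ θ) (Sigmahat θ (δhat ω) ω) α
    (pbar M N W δhat θ ω).ofLp

end Model

end RCC

end

/-! Fix θ and a value of δ̂, and write the sample moment as m + n^{-1/2} Σ^{1/2} u with m its
conditional mean. Then u is a standard Gaussian vector and the constraints become a polyhedron {v :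
⟪e l, v⟫ ≤ h l}. The statistic is the squared distance ‖u - p‖² from u to its projection p. The
moment inequalities say that h ≥ 0, so the mean of u lies in the polyhedron; if all of them bind, h
= 0. This dictionary is `rccTest_unstandardize`.

The level is proved one active set J at a time, by charging the rejections with active set J to a
cell of a partition of the space. The cells are the fibres of `label`: the active set at p when it
contains a nonzero row, and otherwise the set of nearest constraints. It suffices that P(reject,
active set J) ≤ α P(label = J) for every J, because the cells have total mass 1
(`stdGaussian_rej_le`).

If the active rows do not all point in one direction, split u into its components in V = span(e_J)
and in Vᗮ. With the Vᗮ component fixed, J is active iff the V component lies in a translate c + N of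
the normal cone (`act_proj_add_eq_iff`), and h ≥ 0 gives ⟪y, c⟫ ≥ 0 on N. The Cameron-Martin density
of the translated Gaussian therefore decreases along rays of N, so given that J is active the
squared residual is stochastically at most χ² with dim V degrees of freedom
(`stdGaussian_cone_tail_le`).

If the active rows share one direction v, the cone is a half-line, and the charge goes to the larger
cell that also contains the interior points closest to this facet. On a line parallel to v this cell
is a half-line reaching the distance z inside the polyhedron (`label_line_iff`), and z is the
quantity that enters β. Under zero mean the cell has mass Φ(z) and rejection is a one-sided tail,
half of a χ²₁ tail. The level 2αΦ(z) hence yields tail mass αΦ(z), which is α times the cell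
(`gaussianReal_shift_tail_le` also allows a shift).

For h = 0 there are no shifts and the inequalities become equalities. The quantiles are exact
because α ≤ 1/2 keeps 1 - 2αΦ(z) nonnegative. Cells without a nonzero row are empty because A ≠ 0,
and ties between nonparallel nearest constraints are null (`stdGaussian_rej_eq`).

To pass to conditional expectations the test must be jointly measurable in the variance and the
moment (`measurable_rccTest`), and the conditional variance is recovered measurably from the
conditional law (`kernelCov_eq`). -/

noncomputable section

namespace RCC

/-! ### Gaussian measures -/

section Gaussian

open scoped ENNReal RealInnerProductSpace

variable {E : Type*} [NormedAddCommGroup E] [InnerProductSpace ℝ E] [FiniteDimensional ℝ E]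
  [MeasurableSpace E] [BorelSpace E]

/-- A decreasing weight moves mass from the tail `P` of `I` to the rest of `I`. -/
lemma setLIntegral_le_mul_of_tail {X : Type*} [MeasurableSpace X] {μ : Measure X} {P I : Set X}
    (hP : MeasurableSet P) (hI : MeasurableSet I) (hPI : P ⊆ I) {a : ℝ≥0∞} (ha : a ≤ 1)
    (h : μ P ≤ a * μ I) (hfin : μ I ≠ ∞) {m : ℝ≥0∞} {f : X → ℝ≥0∞}
    (hfP : ∀ x ∈ P, f x ≤ m) (hfI : ∀ x ∈ I \ P, m ≤ f x) :
    ∫⁻ x in P, f x ∂μ ≤ a * ∫⁻ x in I, f x ∂μ := by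
  have ha' : a ≠ ∞ := ne_top_of_le_ne_top ENNReal.one_ne_top ha
  have hPfin : μ P ≠ ∞ := ne_top_of_le_ne_top hfin (measure_mono hPI)
  have e1 : ∫⁻ x in I, f x ∂μ = ∫⁻ x in P, f x ∂μ + ∫⁻ x in I \ P, f x ∂μ := by
    rw [← lintegral_inter_add_sdiff f I hP, Set.inter_eq_self_of_subset_right hPI]
  have e2 : μ I = μ P + μ (I \ P) := by
    rw [← measure_inter_add_sdiff I hP, Set.inter_eq_self_of_subset_right hPI]
  have h1 : ∫⁻ x in P, f x ∂μ ≤ m * μ P := by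
    calc ∫⁻ x in P, f x ∂μ ≤ ∫⁻ x in P, m ∂μ := setLIntegral_mono' hP hfP
      _ = m * μ P := by simp
  have h2 : m * μ (I \ P) ≤ ∫⁻ x in I \ P, f x ∂μ := by
    calc m * μ (I \ P) = ∫⁻ x in I \ P, m ∂μ := by simp
      _ ≤ _ := setLIntegral_mono' (hI.diff hP) hfI
  -- The mass hypothesis rearranged to compare `P` with `I \ P`; the level `m` separating the values
  -- of `f` on the two sets carries this over to integrals.
  have h3 : (1 - a) * μ P ≤ a * μ (I \ P) := by
    rw [ENNReal.sub_mul (fun _ _ => hPfin), one_mul, tsub_le_iff_left, ← mul_add, ← e2]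
    exact h
  calc ∫⁻ x in P, f x ∂μ = (1 - a + a) * ∫⁻ x in P, f x ∂μ := by
        rw [tsub_add_cancel_of_le ha, one_mul]
    _ = (1 - a) * ∫⁻ x in P, f x ∂μ + a * ∫⁻ x in P, f x ∂μ := by rw [add_mul]
    _ ≤ a * ∫⁻ x in I \ P, f x ∂μ + a * ∫⁻ x in P, f x ∂μ := by
        refine add_le_add ?_ le_rfl
        calc (1 - a) * ∫⁻ x in P, f x ∂μ ≤ (1 - a) * (m * μ P) := by gcongr
          _ = m * ((1 - a) * μ P) := by ring
          _ ≤ m * (a * μ (I \ P)) := by gcongr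
          _ = a * (m * μ (I \ P)) := by ring
          _ ≤ _ := by gcongr
    _ = a * ∫⁻ x in I, f x ∂μ := by rw [e1, mul_add, add_comm]

variable (E) in
/-- The standard Gaussian measure has a density proportional to `exp (-‖x‖² / 2)`. -/
lemma exists_stdGaussian_eq_withDensity :
    ∃ K : ℝ, 0 < K ∧ stdGaussian E =
      volume.withDensity fun x => ENNReal.ofReal (K * Real.exp (-‖x‖ ^ 2 / 2)) := by
  have hb : (0 : ℝ) < 1 / 2 := by norm_num
  have hI := GaussianFourier.integral_rexp_neg_mul_sq_norm (V := E) hb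
  set I0 : ℝ := ∫ v : E, Real.exp (-(1 / 2) * ‖v‖ ^ 2) with hI0
  have hI0pos : 0 < I0 := by rw [hI]; positivity
  have hint : Integrable (fun v : E => Real.exp (-(1 / 2) * ‖v‖ ^ 2)) := by
    by_contra hc
    rw [hI0, integral_undef hc] at hI0pos
    exact lt_irrefl _ hI0pos
  have hform : ∀ v : E, -‖v‖ ^ 2 / 2 = -(1 / 2) * ‖v‖ ^ 2 := fun v => by ring
  refine ⟨I0⁻¹, inv_pos.2 hI0pos, ?_⟩
  simp_rw [hform]
  have hint' : Integrable (fun v : E => I0⁻¹ * Real.exp (-(1 / 2) * ‖v‖ ^ 2)) := hint.const_mul _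
  have hprob : IsFiniteMeasure (volume.withDensity
      fun x : E => ENNReal.ofReal (I0⁻¹ * Real.exp (-(1 / 2) * ‖x‖ ^ 2))) :=
    isFiniteMeasure_withDensity_ofReal hint'.2
  apply Measure.ext_of_charFun
  ext t
  rw [charFun_stdGaussian, charFun_apply, integral_withDensity_eq_integral_toReal_smul
    (by fun_prop) (by simp)]
  have hre : (0 : ℝ) < ((1 / 2 : ℂ)).re := by norm_num
  -- The Gaussian integral with linear term `I * ⟪t, v⟫` is the characteristic function up to
  -- normalization; the one without it identifies the constant.
  have h0 := GaussianFourier.integral_cexp_neg_mul_sq_norm (V := E) hre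
  have h1 := GaussianFourier.integral_cexp_neg_mul_sq_norm_add (V := E) hre Complex.I t
  have hI0c : (I0 : ℂ) = (Real.pi / (1 / 2 : ℂ)) ^ (Module.finrank ℝ E / 2 : ℂ) := by
    rw [← h0, hI0, ← integral_complex_ofReal]
    congr 1
    ext v
    push_cast
    ring_nf
  have hne : (I0 : ℂ) ≠ 0 := by exact_mod_cast hI0pos.ne'
  calc Complex.exp (-‖t‖ ^ 2 / 2)
      = (I0 : ℂ)⁻¹ * ((I0 : ℂ) * Complex.exp (Complex.I ^ 2 * ‖t‖ ^ 2 / (4 * (1 / 2)))) := by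
        rw [← mul_assoc, inv_mul_cancel₀ hne, one_mul, Complex.I_sq]
        congr 1; ring
    _ = (I0 : ℂ)⁻¹ * ∫ v : E, Complex.exp (-(1 / 2) * ‖v‖ ^ 2 + Complex.I * ⟪t, v⟫) := by
        rw [h1, hI0c]
    _ = _ := by
        rw [← integral_const_mul]
        congr 1
        ext v
        rw [ENNReal.toReal_ofReal (by positivity), Complex.real_smul, Complex.exp_add,
          real_inner_comm v t, mul_comm Complex.I]
        push_cast
        ring

/-- Integration in polar coordinates. -/
lemma lintegral_eq_lintegral_sphere [Nontrivial E] {f : E → ℝ≥0∞} (hf : Measurable f) :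
    ∫⁻ x, f x = ∫⁻ u : Metric.sphere (0 : E) 1, ∫⁻ r : Set.Ioi (0 : ℝ), f ((r : ℝ) • (u : E))
      ∂(Measure.volumeIoiPow (Module.finrank ℝ E - 1)) ∂((volume : Measure E).toSphere) := by
  have hmp := (volume : Measure E).measurePreserving_homeomorphUnitSphereProd
  have h0 : ∫⁻ x, f x = ∫⁻ x in ({0}ᶜ : Set E), f x := by
    rw [restrict_compl_singleton]
  rw [h0, ← lintegral_subtype_comap (measurableSet_singleton 0).compl]
  have : ∀ x : ({0}ᶜ : Set E), f x =
      (fun p : Metric.sphere (0 : E) 1 × Set.Ioi (0 : ℝ) => f ((p.2 : ℝ) • (p.1 : E)))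
        (homeomorphUnitSphereProd E x) := by
    intro x
    have hx : ‖(x : E)‖ ≠ 0 := norm_ne_zero_iff.2 x.2
    simp [smul_smul, hx]
  simp_rw [this]
  have hm : Measurable (fun p : Metric.sphere (0 : E) 1 × Set.Ioi (0 : ℝ) =>
      f ((p.2 : ℝ) • (p.1 : E))) := by fun_prop
  rw [hmp.lintegral_comp hm, lintegral_prod _ hm.aemeasurable]

/-- The standard Gaussian measure in polar coordinates. -/
lemma exists_lintegral_stdGaussian_eq [Nontrivial E] :
    ∃ ν : Measure (Set.Ioi (0 : ℝ)), ∀ f : E → ℝ≥0∞, Measurable f →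
      ∫⁻ x, f x ∂(stdGaussian E) = ∫⁻ u : Metric.sphere (0 : E) 1, ∫⁻ r, f ((r : ℝ) • (u : E)) ∂ν
        ∂((volume : Measure E).toSphere) := by
  obtain ⟨K, hK, h⟩ := exists_stdGaussian_eq_withDensity E
  refine ⟨(Measure.volumeIoiPow (Module.finrank ℝ E - 1)).withDensity
    fun r => ENNReal.ofReal (K * Real.exp (-(r : ℝ) ^ 2 / 2)), fun f hf => ?_⟩
  rw [h, lintegral_withDensity_eq_lintegral_mul _ (by fun_prop) hf,
    lintegral_eq_lintegral_sphere (by fun_prop)]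
  congr 1
  ext u
  rw [lintegral_withDensity_eq_lintegral_mul _ (by fun_prop) (by fun_prop)]
  congr 1
  ext r
  have hu : ‖(u : E)‖ = 1 := by simp
  simp [norm_smul, hu]

/-- The Cameron-Martin formula for the standard Gaussian measure. -/
lemma stdGaussian_sub_mem (c : E) {A : Set E} (hA : MeasurableSet A) :
    stdGaussian E {y | y - c ∈ A} =
      ∫⁻ y in A, ENNReal.ofReal (Real.exp (-⟪y, c⟫ - ‖c‖ ^ 2 / 2)) ∂(stdGaussian E) := by
  obtain ⟨K, hK, h⟩ := exists_stdGaussian_eq_withDensity E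
  have hA' : MeasurableSet {y | y - c ∈ A} := by
    exact (measurable_id.sub_const c) hA
  rw [h, withDensity_apply _ hA', ← lintegral_indicator hA', ← lintegral_indicator hA,
    lintegral_withDensity_eq_lintegral_mul _ (by fun_prop)
      (Measurable.indicator (by fun_prop) hA),
    ← lintegral_add_right_eq_self _ c]
  congr 1
  ext y
  by_cases hy : y ∈ A
  · have : y + c ∈ {y | y - c ∈ A} := by simpa using hy
    rw [Set.indicator_of_mem this, Pi.mul_apply, Set.indicator_of_mem hy,
      ← ENNReal.ofReal_mul (by positivity), mul_assoc, ← Real.exp_add, norm_add_sq_real]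
    congr 3
    ring
  · have : y + c ∉ {y | y - c ∈ A} := by simpa using hy
    rw [Set.indicator_of_notMem this, Pi.mul_apply, Set.indicator_of_notMem hy, mul_zero]

/-- A Gaussian vector whose mean lies in the polar of a cone `N` has, given that it is in `N`, a
stochastically smaller norm than a standard Gaussian vector. -/
lemma stdGaussian_cone_tail_le [Nontrivial E] {N : Set E} (hN : MeasurableSet N)
    (hcone : ∀ y, ∀ t : ℝ, 0 < t → (t • y ∈ N ↔ y ∈ N)) {c : E} (hc : ∀ y ∈ N, 0 ≤ ⟪y, c⟫)
    {s : ℝ} {a : ℝ≥0∞} (ha : a ≤ 1)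
    (h : stdGaussian E {y | s < ‖y‖ ^ 2} ≤ a) :
    stdGaussian E {y | y - c ∈ N ∧ s < ‖y - c‖ ^ 2} ≤ a * stdGaussian E {y | y - c ∈ N} := by
  obtain ⟨ν, hν⟩ := exists_lintegral_stdGaussian_eq (E := E)
  set σ := (volume : Measure E).toSphere with hσ
  have hT : MeasurableSet {y : E | s < ‖y‖ ^ 2} := measurableSet_lt (by fun_prop) (by fun_prop)
  have hT' : MeasurableSet {r : Set.Ioi (0 : ℝ) | s < (r : ℝ) ^ 2} :=
    measurableSet_lt (by fun_prop) (by fun_prop)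
  have hσ0 : σ Set.univ ≠ 0 := by
    rw [Ne, Measure.measure_univ_eq_zero]
    exact Measure.toSphere_ne_zero _
  have hσt : σ Set.univ ≠ ∞ := measure_ne_top _ _
  have hn : ∀ (u : Metric.sphere (0 : E) 1) (r : Set.Ioi (0 : ℝ)),
      ‖(r : ℝ) • (u : E)‖ = r := by
    intro u r
    have hr : (0 : ℝ) < r := r.2
    rw [norm_smul, norm_eq_of_mem_sphere, mul_one, Real.norm_of_nonneg hr.le]
  -- Neither the radial measure `ν` nor the surface measure `σ` is normalized; only the product of
  -- their masses is 1.
  have h1 : ν Set.univ * σ Set.univ = 1 := by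
    have := hν (fun _ => 1) measurable_const
    simpa using this.symm
  have hνt : ν Set.univ ≠ ∞ := by
    intro hh
    rw [hh, ENNReal.top_mul hσ0] at h1
    exact ENNReal.top_ne_one h1
  have h2 : ν {r | s < (r : ℝ) ^ 2} ≤ a * ν Set.univ := by
    have := hν ({y : E | s < ‖y‖ ^ 2}.indicator 1) (measurable_one.indicator hT)
    rw [lintegral_indicator_one hT] at this
    have h3 : ∀ u : Metric.sphere (0 : E) 1,
        ∫⁻ r, {y : E | s < ‖y‖ ^ 2}.indicator 1 ((r : ℝ) • (u : E)) ∂ν =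
          ν {r | s < (r : ℝ) ^ 2} := by
      intro u
      rw [← lintegral_indicator_one hT']
      congr 1
      ext r
      simp [Set.indicator, hn]
    simp_rw [h3] at this
    rw [lintegral_const] at this
    rw [this] at h
    rw [← ENNReal.mul_le_mul_iff_left hσ0 hσt, mul_assoc, h1, mul_one]
    exact h
  have e1 : {y | y - c ∈ N ∧ s < ‖y - c‖ ^ 2} = {y | y - c ∈ N ∩ {y | s < ‖y‖ ^ 2}} := rfl
  rw [e1, stdGaussian_sub_mem c (hN.inter hT), stdGaussian_sub_mem c hN,
    ← lintegral_indicator (hN.inter hT), ← lintegral_indicator hN,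
    hν _ (Measurable.indicator (by fun_prop) (hN.inter hT)),
    hν _ (Measurable.indicator (by fun_prop) hN)]
  rw [← lintegral_const_mul' _ _ (ne_top_of_le_ne_top ENNReal.one_ne_top ha)]
  refine lintegral_mono fun u => ?_
  by_cases hu : (u : E) ∈ N
  · have hmem : ∀ r : Set.Ioi (0 : ℝ), (r : ℝ) • (u : E) ∈ N := fun r => (hcone _ _ r.2).2 hu
    set f : Set.Ioi (0 : ℝ) → ℝ≥0∞ := fun r =>
      ENNReal.ofReal (Real.exp (-⟪(r : ℝ) • (u : E), c⟫ - ‖c‖ ^ 2 / 2)) with hf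
    -- Along the ray through `u` the density decreases in the radius since `⟪u, c⟫ ≥ 0`; `m` is its
    -- value at radius `√s`. For negative `s` the junk value `√s = 0` still works, as the tail is
    -- then the whole ray.
    have key := setLIntegral_le_mul_of_tail (μ := ν) (f := f)
      (m := ENNReal.ofReal (Real.exp (-(Real.sqrt s * ⟪(u : E), c⟫) - ‖c‖ ^ 2 / 2)))
      hT' MeasurableSet.univ (Set.subset_univ _) ha h2 hνt ?_ ?_
    · rw [← lintegral_indicator hT', setLIntegral_univ] at key
      convert key using 2
      · ext r
        by_cases hr : s < (r : ℝ) ^ 2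
        · have h5 : (r : ℝ) • (u : E) ∈ N ∩ {y | s < ‖y‖ ^ 2} := ⟨hmem r, by simpa [hn] using hr⟩
          have h6 : r ∈ {r : Set.Ioi (0 : ℝ) | s < (r : ℝ) ^ 2} := hr
          rw [Set.indicator_of_mem h5, Set.indicator_of_mem h6]
        · have h5 : (r : ℝ) • (u : E) ∉ N ∩ {y | s < ‖y‖ ^ 2} :=
            fun h => hr (by simpa [hn] using h.2)
          have h6 : r ∉ {r : Set.Ioi (0 : ℝ) | s < (r : ℝ) ^ 2} := hr
          rw [Set.indicator_of_notMem h5, Set.indicator_of_notMem h6]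
      · congr 1
        ext r
        rw [Set.indicator_of_mem (hmem r)]
    · intro r hr
      have h4 : Real.sqrt s ≤ r := Real.sqrt_le_iff.2 ⟨(Set.mem_Ioi.1 r.2).le, le_of_lt hr⟩
      have := mul_le_mul_of_nonneg_right h4 (hc _ hu)
      dsimp only [f]
      rw [real_inner_smul_left]
      gcongr
    · intro r hr
      have h4 : (r : ℝ) ≤ Real.sqrt s := by
        apply Real.le_sqrt_of_sq_le
        simpa using hr.2
      have := mul_le_mul_of_nonneg_right h4 (hc _ hu)
      dsimp only [f]
      rw [real_inner_smul_left]
      gcongr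
  · have hmem : ∀ r : Set.Ioi (0 : ℝ), (r : ℝ) • (u : E) ∉ N :=
      fun r h => hu ((hcone _ _ r.2).1 h)
    have : ∀ r : Set.Ioi (0 : ℝ), (N ∩ {y | s < ‖y‖ ^ 2}).indicator (fun y : E =>
        ENNReal.ofReal (Real.exp (-⟪y, c⟫ - ‖c‖ ^ 2 / 2))) ((r : ℝ) • (u : E)) = 0 :=
      fun r => Set.indicator_of_notMem (fun h => hmem r h.1) _
    simp [this]

/-- The norm of a standard Gaussian vector is independent of its direction. -/
lemma stdGaussian_cone_tail_eq [Nontrivial E] {N : Set E} (hN : MeasurableSet N)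
    (hcone : ∀ y, ∀ t : ℝ, 0 < t → (t • y ∈ N ↔ y ∈ N))
    (s : ℝ) :
    stdGaussian E {y | y ∈ N ∧ s < ‖y‖ ^ 2} =
      stdGaussian E {y | s < ‖y‖ ^ 2} * stdGaussian E N := by
  -- With zero shift the bound holds for `N` and for its complement, also a cone. The two bounds add
  -- up to an equality, so each is one.
  have h1 := stdGaussian_cone_tail_le hN hcone (c := 0) (s := s) (by simp) prob_le_one le_rfl
  have h2 := stdGaussian_cone_tail_le hN.compl (fun y t ht => not_congr (hcone y t ht)) (c := 0) (s := s)
    (by simp) prob_le_one le_rfl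
  simp only [sub_zero, Set.ofPred_mem_eq] at h1 h2
  set a := stdGaussian E {y | s < ‖y‖ ^ 2} with ha
  refine le_antisymm h1 ?_
  have h3 : a = stdGaussian E {y | y ∈ N ∧ s < ‖y‖ ^ 2} +
      stdGaussian E {y | y ∈ Nᶜ ∧ s < ‖y‖ ^ 2} := by
    rw [ha, ← measure_inter_add_sdiff {y : E | s < ‖y‖ ^ 2} hN]
    congr 2
    · ext y; simp [and_comm]
    · ext y; simp [and_comm]
  have h4 : a = a * stdGaussian E N + a * stdGaussian E Nᶜ := by
    rw [← mul_add, measure_add_measure_compl hN, measure_univ, mul_one]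
  have h5 : a * stdGaussian E N + a * stdGaussian E Nᶜ ≤
      stdGaussian E {y | y ∈ N ∧ s < ‖y‖ ^ 2} + a * stdGaussian E Nᶜ := by
    rw [← h4]
    conv_lhs => rw [h3]
    gcongr
  exact (ENNReal.add_le_add_iff_right
    (ENNReal.mul_ne_top (measure_ne_top _ _) (measure_ne_top _ _))).1 h5

lemma stdGaussian_real : stdGaussian ℝ = gaussianReal 0 1 := by
  apply Measure.ext_of_charFun
  ext t
  rw [charFun_stdGaussian, charFun_gaussianReal]
  simp [neg_div, ← Complex.ofReal_pow]

/-- The components of a standard Gaussian vector in a subspace and in its orthogonal complement are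
independent standard Gaussian vectors. -/
lemma lintegral_stdGaussian_submodule (V : Submodule ℝ E) {f : E → ℝ≥0∞} (hf : Measurable f) :
    ∫⁻ x, f x ∂(stdGaussian E) =
      ∫⁻ q, ∫⁻ y, f ((y : V) + (q : Vᗮ)) ∂(stdGaussian V) ∂(stdGaussian Vᗮ) := by
  have h1 : ((stdGaussian V).prod (stdGaussian Vᗮ)).map (WithLp.toLp 2) =
      stdGaussian (WithLp 2 (V × Vᗮ)) := by
    apply Measure.ext_of_charFun
    ext t
    have ht : (‖t‖ : ℂ) ^ 2 = (‖t.ofLp.1‖ : ℂ) ^ 2 + (‖t.ofLp.2‖ : ℂ) ^ 2 := by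
      exact_mod_cast WithLp.prod_norm_sq_eq_of_L2 t
    rw [charFun_prod, charFun_stdGaussian, charFun_stdGaussian, charFun_stdGaussian,
      ← Complex.exp_add, ht]
    congr 1
    ring
  rw [← stdGaussian_map V.orthogonalDecomposition.symm, ← h1,
    lintegral_map hf (LinearIsometryEquiv.continuous _).measurable,
    lintegral_map (by
      exact hf.comp (V.orthogonalDecomposition.symm.continuous.measurable)) (by fun_prop),
    lintegral_prod_symm _ (by
      apply Measurable.aemeasurable
      exact (hf.comp (V.orthogonalDecomposition.symm.continuous.measurable)).comp (by fun_prop))]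
  simp [Submodule.orthogonalDecomposition_symm_apply]

/-- The component of a standard Gaussian vector in a given direction is standard normal and
independent of the orthogonal component. -/
lemma lintegral_stdGaussian_line {v : E} (hv : ‖v‖ = 1) {f : E → ℝ≥0∞} (hf : Measurable f) :
    ∫⁻ x, f x ∂(stdGaussian E) =
      ∫⁻ q, ∫⁻ t : ℝ, f (t • v + (q : (ℝ ∙ v)ᗮ)) ∂(gaussianReal 0 1) ∂(stdGaussian (ℝ ∙ v)ᗮ) := by
  rw [lintegral_stdGaussian_submodule (ℝ ∙ v) hf]
  congr 1
  ext q
  rw [← stdGaussian_map (LinearIsometryEquiv.toSpanUnitSingleton v hv), stdGaussian_real,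
    lintegral_map (by fun_prop) (LinearIsometryEquiv.continuous _).measurable]
  rfl

end Gaussian

/-! ### Chi-squared quantiles and the normal distribution function -/

section Quantile

open scoped ENNReal RealInnerProductSpace

instance isProbabilityMeasure_chiSq (r : ℕ) : IsProbabilityMeasure (chiSq r) :=
  Measure.isProbabilityMeasure_map (by fun_prop)

lemma stdGaussian_norm_sq_tail {V : Type*} [NormedAddCommGroup V] [InnerProductSpace ℝ V]
    [FiniteDimensional ℝ V] [MeasurableSpace V] [BorelSpace V] (s : ℝ) :
    stdGaussian V {y | s < ‖y‖ ^ 2} = chiSq (Module.finrank ℝ V) (Set.Ioi s) := by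
  rw [chiSq, Measure.map_apply (by fun_prop) measurableSet_Ioi,
    ← stdGaussian_map (stdOrthonormalBasis ℝ V).repr,
    Measure.map_apply (LinearIsometryEquiv.continuous _).measurable
      ((by fun_prop : Measurable fun z : EuclideanSpace ℝ _ => ‖z‖ ^ 2) measurableSet_Ioi)]
  congr 1
  ext y
  simp

lemma chiSqQuantile_nonneg (r : ℕ) (q : ℝ) : 0 ≤ chiSqQuantile r q :=
  Real.sInf_nonneg fun _ h => h.1

lemma chiSqQuantile_set_nonempty (r : ℕ) {q : ℝ} (hq : q < 1) :
    {x : ℝ | 0 ≤ x ∧ q ≤ (chiSq r).real (Set.Iic x)}.Nonempty := by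
  have h := tendsto_cdf_atTop (chiSq r)
  obtain ⟨x, hx, hx0⟩ := ((h.eventually (lt_mem_nhds hq)).and
    (Filter.eventually_ge_atTop 0)).exists
  refine ⟨x, hx0, ?_⟩
  rw [← cdf_eq_real]
  exact hx.le

/-- A rational witness turns the comparison with a quantile into countably many conditions on `q`
and `T`, which is what measurability for a random level needs. -/
lemma chiSqQuantile_lt_iff (r : ℕ) {q : ℝ} (hq : q < 1) (T : ℝ) :
    chiSqQuantile r q < T ↔
      ∃ x : ℚ, 0 ≤ (x : ℝ) ∧ (x : ℝ) < T ∧ q ≤ (chiSq r).real (Set.Iic (x : ℝ)) := by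
  constructor
  · intro h
    obtain ⟨y, hy, hyT⟩ := exists_lt_of_csInf_lt (chiSqQuantile_set_nonempty r hq) h
    obtain ⟨x, hx1, hx2⟩ := exists_rat_btwn hyT
    exact ⟨x, hy.1.trans hx1.le, hx2,
      hy.2.trans (measureReal_mono (Set.Iic_subset_Iic.2 hx1.le))⟩
  · rintro ⟨x, hx0, hxT, hx⟩
    have h : (x : ℝ) ∈ {x : ℝ | 0 ≤ x ∧ q ≤ (chiSq r).real (Set.Iic x)} := ⟨hx0, hx⟩
    exact (csInf_le ⟨0, fun _ h => h.1⟩ h).trans_lt hxT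

/-- The infimum defining the quantile is attained, by right continuity of the distribution function.
-/
lemma le_chiSq_Iic_quantile (r : ℕ) {q : ℝ} (hq : q < 1) :
    q ≤ (chiSq r).real (Set.Iic (chiSqQuantile r q)) := by
  rw [← cdf_eq_real]
  have hc := (cdf (chiSq r)).right_continuous (chiSqQuantile r q)
  have hc' := hc.mono_left (nhdsWithin_mono _ Set.Ioi_subset_Ici_self)
  refine ge_of_tendsto hc' ?_
  filter_upwards [self_mem_nhdsWithin] with x hx
  obtain ⟨y, hy0, hyx, hy⟩ := (chiSqQuantile_lt_iff r hq x).1 hx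
  rw [← cdf_eq_real] at hy
  exact hy.trans (monotone_cdf _ hyx.le)

lemma chiSq_Ioi_eq (r : ℕ) (s : ℝ) :
    chiSq r (Set.Ioi s) = ENNReal.ofReal (1 - (chiSq r).real (Set.Iic s)) := by
  rw [← Set.compl_Iic, ← ofReal_measureReal, probReal_compl_eq_one_sub measurableSet_Iic]

lemma chiSq_Ioi_quantile_le (r : ℕ) {q : ℝ} (hq : q < 1) :
    chiSq r (Set.Ioi (chiSqQuantile r q)) ≤ ENNReal.ofReal (1 - q) := by
  rw [chiSq_Ioi_eq]
  have := le_chiSq_Iic_quantile r hq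
  gcongr

/-- The event is a sphere, Lebesgue-null in positive dimension. -/
lemma chiSq_singleton {r : ℕ} (hr : 0 < r) (s : ℝ) : chiSq r {s} = 0 := by
  have : Nonempty (Fin r) := ⟨⟨0, hr⟩⟩
  obtain ⟨K, hK, h⟩ := exists_stdGaussian_eq_withDensity (EuclideanSpace ℝ (Fin r))
  rw [chiSq, Measure.map_apply (by fun_prop) (measurableSet_singleton s), h]
  refine withDensity_absolutelyContinuous _ _ ?_
  refine measure_mono_null (t := Metric.sphere 0 (Real.sqrt s)) ?_
    (Measure.addHaar_sphere _ _ _)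
  intro z hz
  have hz' : ‖z‖ ^ 2 = s := hz
  rw [mem_sphere_zero_iff_norm, ← hz', Real.sqrt_sq (norm_nonneg _)]

/-- Without atoms the distribution function does not jump over `q`. The condition `0 ≤ q` is
essential: for negative `q` the quantile is 0 and the tail has mass 1. -/
lemma chiSq_Ioi_quantile_eq {r : ℕ} (hr : 0 < r) {q : ℝ} (hq0 : 0 ≤ q) (hq : q < 1) :
    chiSq r (Set.Ioi (chiSqQuantile r q)) = ENNReal.ofReal (1 - q) := by
  rw [chiSq_Ioi_eq]
  congr 2
  refine le_antisymm ?_ (le_chiSq_Iic_quantile r hq)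
  rw [measureReal_congr (Iio_ae_eq_Iic' (chiSq_singleton hr _)).symm]
  -- Every rational `x` below the quantile has `P(χ² ≤ x) ≤ q`: a nonnegative one would otherwise
  -- belong to the defining set, and a negative one carries no mass.
  have hU : Set.Iio (chiSqQuantile r q) = ⋃ x : {x : ℚ // (x : ℝ) < chiSqQuantile r q},
      Set.Iic (x.1 : ℝ) := by
    ext y
    simp only [Set.mem_Iio, Set.mem_iUnion, Set.mem_Iic, Subtype.exists, exists_prop]
    constructor
    · intro hy
      obtain ⟨x, h1, h2⟩ := exists_rat_btwn hy
      exact ⟨x, h2, h1.le⟩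
    · rintro ⟨x, h1, h2⟩
      exact h2.trans_lt h1
  rw [measureReal_def]
  refine ENNReal.toReal_le_of_le_ofReal hq0 ?_
  have hdir : Directed (· ⊆ ·)
      fun x : {x : ℚ // (x : ℝ) < chiSqQuantile r q} => Set.Iic (x.1 : ℝ) := by
    apply Monotone.directed_le
    intro x y hxy
    exact Set.Iic_subset_Iic.2 (by exact_mod_cast hxy)
  rw [hU, hdir.measure_iUnion]
  refine iSup_le fun x => ?_
  rw [← ofReal_measureReal]
  apply ENNReal.ofReal_le_ofReal
  by_contra! hc
  rcases lt_or_ge (x.1 : ℝ) 0 with h0 | h0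
  · have : (chiSq r).real (Set.Iic (x.1 : ℝ)) = 0 := by
      rw [chiSq, map_measureReal_apply (by fun_prop) measurableSet_Iic]
      have : (fun z : EuclideanSpace ℝ (Fin r) => ‖z‖ ^ 2) ⁻¹' Set.Iic (x.1 : ℝ) = ∅ := by
        ext z
        have : 0 ≤ ‖z‖ ^ 2 := by positivity
        simp only [Set.mem_preimage, Set.mem_Iic, Set.mem_empty_iff_false, iff_false, not_le]
        linarith
      rw [this, measureReal_empty]
    linarith
  · have h1 : chiSqQuantile r q ≤ x.1 := csInf_le ⟨0, fun _ h => h.1⟩ ⟨h0, hc.le⟩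
    exact absurd x.2 (not_lt.2 h1)

lemma stdNormalCDF_mono : Monotone stdNormalCDF := fun _ _ h =>
  measureReal_mono fun _ hx => le_trans hx h

lemma stdNormalCDF_le_one (z : EReal) : stdNormalCDF z ≤ 1 := measureReal_le_one

lemma gaussianReal_neg_preimage {A : Set ℝ} (hA : MeasurableSet A) :
    gaussianReal 0 1 {t | -t ∈ A} = gaussianReal 0 1 A := by
  have h := gaussianReal_map_neg (μ := 0) (v := 1)
  rw [neg_zero] at h
  conv_rhs => rw [← h, Measure.map_apply (by fun_prop) hA]
  rfl

instance nullSingletonClass_gaussianReal_zero_one : NullSingletonClass (gaussianReal 0 1) :=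
  nullSingletonClass_gaussianReal one_ne_zero

/-- By symmetry and absence of atoms. The open half-line `t > -z` is the form in which the cell of a
facet appears on a line. -/
lemma gaussianReal_neg_lt (z : EReal) :
    gaussianReal 0 1 {t | ((-t : ℝ) : EReal) < z} = ENNReal.ofReal (stdNormalCDF z) := by
  have hm : MeasurableSet {t : ℝ | (t : EReal) < z} :=
    measurableSet_lt measurable_coe_real_ereal measurable_const
  rw [stdNormalCDF, ofReal_measureReal]
  refine (gaussianReal_neg_preimage hm).trans ?_
  refine le_antisymm (measure_mono fun x (hx : (x : EReal) < z) =>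
    show (x : EReal) ≤ z from hx.le) ?_
  have hsub : {x : ℝ | (x : EReal) ≤ z} ⊆ {t : ℝ | (t : EReal) < z} ∪ {z.toReal} := by
    intro x hx
    rcases lt_or_eq_of_le (show (x : EReal) ≤ z from hx) with h | h
    · exact Or.inl h
    · right
      simp [← h]
  refine (measure_mono hsub).trans ((measure_union_le _ _).trans ?_)
  simp

lemma stdNormalCDF_zero : stdNormalCDF 0 = 1 / 2 := by
  have h := gaussianReal_neg_lt 0
  have e1 : {t : ℝ | ((-t : ℝ) : EReal) < 0} = Set.Ioi 0 := by
    ext t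
    simp only [Set.mem_ofPred_eq, Set.mem_Ioi]
    norm_cast
    simp
  have h3 : stdNormalCDF 0 = (gaussianReal 0 1).real (Set.Iic 0) := by
    rw [stdNormalCDF]
    congr 1
    ext t
    simp
  have h4 : (gaussianReal 0 1).real (Set.Ioi 0) = stdNormalCDF 0 := by
    rw [measureReal_def, ← e1, h, ENNReal.toReal_ofReal]
    exact measureReal_nonneg
  have h5 := probReal_compl_eq_one_sub (μ := gaussianReal 0 1) (measurableSet_Iic (a := (0 : ℝ)))
  rw [Set.compl_Iic, h4, ← h3] at h5
  linarith

lemma half_le_stdNormalCDF {z : EReal} (hz : 0 ≤ z) : 1 / 2 ≤ stdNormalCDF z := by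
  rw [← stdNormalCDF_zero]
  exact stdNormalCDF_mono hz

lemma gaussianReal_sqrt_lt {s : ℝ} (hs : 0 ≤ s) :
    2 * gaussianReal 0 1 {t | Real.sqrt s < t} = chiSq 1 (Set.Ioi s) := by
  have h1 := stdGaussian_norm_sq_tail (V := ℝ) s
  rw [Module.finrank_self] at h1
  rw [← h1, stdGaussian_real]
  have e1 : {y : ℝ | s < ‖y‖ ^ 2} = {t | Real.sqrt s < t} ∪ {t | -t ∈ Set.Ioi (Real.sqrt s)} := by
    ext y
    simp only [Set.mem_ofPred_eq, Set.mem_union, Set.mem_Ioi, Real.norm_eq_abs]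
    rw [← Real.sqrt_lt_sqrt_iff hs, Real.sqrt_sq (abs_nonneg y), lt_abs]
  have hm : MeasurableSet {t : ℝ | -t ∈ Set.Ioi (Real.sqrt s)} := measurable_neg measurableSet_Ioi
  rw [e1, measure_union _ hm, gaussianReal_neg_preimage measurableSet_Ioi, two_mul]
  · rfl
  · rw [Set.disjoint_left]
    intro t h1 h2
    simp only [Set.mem_ofPred_eq, Set.mem_Ioi] at h1 h2
    have := Real.sqrt_nonneg s
    linarith

/-- The reason for the factor `2Φ(z)` in the refined level: the one-sided tail is half of a `χ²₁`
tail of mass at most `2αΦ(z)`, and `Φ(z)` is the mass of `(-z, ∞)`. The bound `z ≥ 0` keeps `Φ(z)`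
positive, hence the quantile level below 1. -/
lemma gaussianReal_sqrt_quantile_lt_le {α : ℝ} (hα : 0 < α) {z : EReal} (hz : 0 ≤ z) :
    gaussianReal 0 1 {t | Real.sqrt (chiSqQuantile 1 (1 - 2 * α * stdNormalCDF z)) < t} ≤
      ENNReal.ofReal α * gaussianReal 0 1 {t | ((-t : ℝ) : EReal) < z} := by
  have h1 := half_le_stdNormalCDF hz
  have hpos : 0 < 2 * α * stdNormalCDF z := by positivity
  have h2 := chiSq_Ioi_quantile_le 1 (q := 1 - 2 * α * stdNormalCDF z) (by linarith)
  rw [← gaussianReal_sqrt_lt (chiSqQuantile_nonneg _ _), sub_sub_cancel, mul_assoc,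
    ENNReal.ofReal_mul (by norm_num), ENNReal.ofReal_mul hα.le, ← gaussianReal_neg_lt,
    ENNReal.ofReal_ofNat] at h2
  rw [← mul_assoc 2 α] at h2
  exact (ENNReal.mul_le_mul_iff_right two_ne_zero ENNReal.ofNat_ne_top).1 h2

/-- Here `α ≤ 1/2` ensures `1 - 2αΦ(z) ≥ 0`, where the quantile has exact tail mass. -/
lemma gaussianReal_sqrt_quantile_lt_eq {α : ℝ} (hα : 0 < α) (hα2 : α ≤ 1 / 2) {z : EReal}
    (hz : 0 ≤ z) :
    gaussianReal 0 1 {t | Real.sqrt (chiSqQuantile 1 (1 - 2 * α * stdNormalCDF z)) < t} =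
      ENNReal.ofReal α * gaussianReal 0 1 {t | ((-t : ℝ) : EReal) < z} := by
  have h1 := half_le_stdNormalCDF hz
  have h1' := stdNormalCDF_le_one z
  have hpos : 0 < 2 * α * stdNormalCDF z := by positivity
  have h2 := chiSq_Ioi_quantile_eq one_pos (q := 1 - 2 * α * stdNormalCDF z) (by nlinarith)
    (by linarith)
  rw [← gaussianReal_sqrt_lt (chiSqQuantile_nonneg _ _), sub_sub_cancel, mul_assoc,
    ENNReal.ofReal_mul (by norm_num), ENNReal.ofReal_mul hα.le, ← gaussianReal_neg_lt,
    ENNReal.ofReal_ofNat] at h2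
  rw [← mul_assoc 2 α] at h2
  exact (ENNReal.mul_right_inj two_ne_zero ENNReal.ofNat_ne_top).1 h2

/-- The one-sided version of the tail comparison: for a normal variable with nonpositive mean `-η`,
the refined critical value controls the tail relative to the half line `(-z, ∞)`. -/
lemma gaussianReal_shift_tail_le {α : ℝ} (hα : 0 < α) (hα1 : α ≤ 1) {z : EReal} (hz : 0 ≤ z)
    {η : ℝ} (hη : 0 ≤ η) :
    gaussianReal 0 1 {t | Real.sqrt (chiSqQuantile 1 (1 - 2 * α * stdNormalCDF z)) < t - η} ≤
      ENNReal.ofReal α * gaussianReal 0 1 {t | ((η - t : ℝ) : EReal) < z} := by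
  set s := Real.sqrt (chiSqQuantile 1 (1 - 2 * α * stdNormalCDF z)) with hs
  have hP : MeasurableSet {t : ℝ | s < t} := measurableSet_Ioi
  have hI : MeasurableSet {t : ℝ | ((-t : ℝ) : EReal) < z} :=
    measurableSet_lt (measurable_coe_real_ereal.comp measurable_neg) measurable_const
  have h1 := stdGaussian_sub_mem η hP
  have h2 := stdGaussian_sub_mem η hI
  rw [stdGaussian_real] at h1 h2
  have e1 : {t | ((η - t : ℝ) : EReal) < z} = {t | t - η ∈ {t : ℝ | ((-t : ℝ) : EReal) < z}} := by
    ext t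
    simp only [Set.mem_ofPred_eq, neg_sub]
  have e2 : {t | s < t - η} = {t | t - η ∈ {t : ℝ | s < t}} := rfl
  rw [e1, e2, h1, h2]
  -- Since `η ≥ 0`, the Cameron-Martin density is decreasing in `t`; `m` is its value at the
  -- critical value `s`.
  refine setLIntegral_le_mul_of_tail (m := ENNReal.ofReal (Real.exp (-(s * η) - ‖η‖ ^ 2 / 2)))
    hP hI ?_ ?_ (gaussianReal_sqrt_quantile_lt_le hα hz) (measure_ne_top _ _) ?_ ?_
  · intro t ht
    have h3 : -t < 0 := by
      have : 0 ≤ s := Real.sqrt_nonneg _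
      have : s < t := ht
      linarith
    exact lt_of_lt_of_le (by exact_mod_cast h3) hz
  · simpa using hα1
  · intro t ht
    have : s < t := ht
    have := mul_le_mul_of_nonneg_right this.le hη
    have h3 : ⟪t, η⟫ = t * η := by simp [mul_comm]
    rw [h3]
    gcongr
  · intro t ht
    have : t ≤ s := not_lt.1 ht.2
    have := mul_le_mul_of_nonneg_right this hη
    have h3 : ⟪t, η⟫ = t * η := by simp [mul_comm]
    rw [h3]
    gcongr

end Quantile

/-! ### Projection onto a polyhedron -/

section Polyhedron

open scoped ENNReal RealInnerProductSpace

variable {E : Type*} [NormedAddCommGroup E] [InnerProductSpace ℝ E] {k : ℕ}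

/-- The polyhedron `{v : ⟪e l, v⟫ ≤ h l for all l}`. -/
def poly (e : Fin k → E) (h : Fin k → ℝ) : Set E := {v | ∀ l, ⟪e l, v⟫ ≤ h l}

/-- The active constraints at a point. -/
def act (e : Fin k → E) (h : Fin k → ℝ) (v : E) : Finset (Fin k) :=
  Finset.univ.filter fun l => ⟪e l, v⟫ = h l

/-- The cone generated by the vectors `e j`, `j ∈ J`, as a bipolar. -/
def normalCone (e : Fin k → E) (J : Finset (Fin k)) : Set E :=
  {y | ∀ d, (∀ j ∈ J, ⟪e j, d⟫ ≤ 0) → ⟪y, d⟫ ≤ 0}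

open Classical in
/-- The projection onto a nonempty polyhedron. -/
def proj (e : Fin k → E) (h : Fin k → ℝ) (u : E) : E :=
  if H : ∃ p ∈ poly e h, ∀ w ∈ poly e h, ⟪u - p, w - p⟫ ≤ 0 then H.choose else 0

variable {e : Fin k → E} {h : Fin k → ℝ}

@[simp] lemma mem_act {v : E} {l : Fin k} : l ∈ act e h v ↔ ⟪e l, v⟫ = h l := by simp [act]

lemma isClosed_poly : IsClosed (poly e h) := by
  have : poly e h = ⋂ l, {v | ⟪e l, v⟫ ≤ h l} := by
    ext v
    simp [poly]
  rw [this]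
  exact isClosed_iInter fun l => isClosed_le (by fun_prop) (by fun_prop)

lemma convex_poly : Convex ℝ (poly e h) := by
  intro x hx y hy a b ha hb hab l
  rw [inner_add_right, real_inner_smul_right, real_inner_smul_right]
  calc a * ⟪e l, x⟫ + b * ⟪e l, y⟫ ≤ a * h l + b * h l := by
        gcongr
        · exact hx l
        · exact hy l
    _ = h l := by rw [← add_mul, hab, one_mul]

lemma exists_proj [FiniteDimensional ℝ E] (hne : (poly e h).Nonempty) (u : E) :
    ∃ p ∈ poly e h, ∀ w ∈ poly e h, ⟪u - p, w - p⟫ ≤ 0 := by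
  obtain ⟨p, hp, hmin⟩ := exists_norm_eq_iInf_of_complete_convex hne
    isClosed_poly.isComplete convex_poly u
  exact ⟨p, hp, (norm_eq_iInf_iff_real_inner_le_zero convex_poly hp).1 hmin⟩

lemma variational_unique {u p p' : E} (hp : p ∈ poly e h) (hp' : p' ∈ poly e h)
    (H : ∀ w ∈ poly e h, ⟪u - p, w - p⟫ ≤ 0) (H' : ∀ w ∈ poly e h, ⟪u - p', w - p'⟫ ≤ 0) :
    p = p' := by
  have h1 := H p' hp'
  have h2 := H' p hp
  have h3 : ⟪p - p', p - p'⟫ = ⟪u - p, p' - p⟫ + ⟪u - p', p - p'⟫ := by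
    rw [← neg_sub p p', inner_neg_right, neg_add_eq_sub, ← inner_sub_left]
    congr 1
    abel
  have h4 : ⟪p - p', p - p'⟫ = 0 := le_antisymm (by linarith) real_inner_self_nonneg
  exact sub_eq_zero.1 (inner_self_eq_zero.1 h4)

lemma proj_eq_of {u p : E} (hp : p ∈ poly e h) (H : ∀ w ∈ poly e h, ⟪u - p, w - p⟫ ≤ 0) :
    proj e h u = p := by
  have hex : ∃ p ∈ poly e h, ∀ w ∈ poly e h, ⟪u - p, w - p⟫ ≤ 0 := ⟨p, hp, H⟩
  rw [proj, dif_pos hex]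
  exact variational_unique hex.choose_spec.1 hp hex.choose_spec.2 H

lemma isClosed_normalCone (J : Finset (Fin k)) : IsClosed (normalCone e J) := by
  have : normalCone e J = ⋂ d, ⋂ (_ : ∀ j ∈ J, ⟪e j, d⟫ ≤ 0), {y | ⟪y, d⟫ ≤ 0} := by
    ext y
    simp [normalCone]
  rw [this]
  exact isClosed_iInter fun d => isClosed_iInter fun _ => isClosed_le (by fun_prop) (by fun_prop)

lemma smul_mem_normalCone (J : Finset (Fin k)) (y : E) {t : ℝ} (ht : 0 < t) :
    t • y ∈ normalCone e J ↔ y ∈ normalCone e J := by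
  refine forall_congr' fun d => imp_congr_right fun _ => ?_
  rw [real_inner_smul_left]
  constructor
  · intro h; exact nonpos_of_mul_nonpos_right h ht
  · intro h; exact mul_nonpos_of_nonneg_of_nonpos ht.le h

section Finite

variable [FiniteDimensional ℝ E]

lemma proj_spec (hne : (poly e h).Nonempty) (u : E) :
    proj e h u ∈ poly e h ∧ ∀ w ∈ poly e h, ⟪u - proj e h u, w - proj e h u⟫ ≤ 0 := by
  obtain ⟨p, hp, H⟩ := exists_proj hne u
  rw [proj_eq_of hp H]
  exact ⟨hp, H⟩

lemma continuous_proj (hne : (poly e h).Nonempty) : Continuous (proj e h) := by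
  have : LipschitzWith 1 (proj e h) := by
    refine LipschitzWith.of_dist_le_mul fun u v => ?_
    simp only [NNReal.coe_one, one_mul, dist_eq_norm]
    set p := proj e h u
    set q := proj e h v
    have h1 := (proj_spec hne u).2 q (proj_spec hne v).1
    have h2 := (proj_spec hne v).2 p (proj_spec hne u).1
    have h3 : ⟪p - q, p - q⟫ ≤ ⟪u - v, p - q⟫ := by
      have : ⟪u - v, p - q⟫ - ⟪p - q, p - q⟫ = -(⟪u - p, q - p⟫ + ⟪v - q, p - q⟫) := by
        rw [← neg_sub p q, inner_neg_right, neg_add_eq_sub, ← inner_sub_left, ← inner_sub_left,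
          ← inner_neg_left]
        congr 1
        abel
      linarith
    have h4 := real_inner_le_norm (u - v) (p - q)
    rw [real_inner_self_eq_norm_sq] at h3
    rcases (norm_nonneg (p - q)).eq_or_lt with h0 | h0
    · rw [← h0]; positivity
    · exact le_of_mul_le_mul_right (by nlinarith) h0
  exact this.continuous

/-- The first-order conditions of the projection: only the constraints active at `κ` restrict small
displacements. -/
lemma proj_eq_iff (hne : (poly e h).Nonempty) {u κ : E} :
    proj e h u = κ ↔ κ ∈ poly e h ∧ u - κ ∈ normalCone e (act e h κ) := by
  constructor
  · rintro rfl
    obtain ⟨h1, h2⟩ := proj_spec hne u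
    set κ := proj e h u
    refine ⟨h1, fun d hd => ?_⟩
    -- A short step along `d` stays in the polyhedron: inactive constraints have slack at `κ`, and
    -- active ones do not increase along `d`.
    have hev : ∀ᶠ ε : ℝ in nhdsWithin 0 (Set.Ioi 0), ∀ l, ⟪e l, κ + ε • d⟫ ≤ h l := by
      rw [Filter.eventually_all]
      intro l
      by_cases hl : ⟪e l, κ⟫ = h l
      · filter_upwards [self_mem_nhdsWithin] with ε hε
        rw [inner_add_right, real_inner_smul_right, hl]
        have := hd l (mem_act.2 hl)
        have hε' : (0 : ℝ) < ε := hε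
        nlinarith
      · have hlt : ⟪e l, κ⟫ < h l := lt_of_le_of_ne (h1 l) hl
        have hc : Continuous fun ε : ℝ => ⟪e l, κ + ε • d⟫ := by fun_prop
        have : ∀ᶠ ε : ℝ in nhds 0, ⟪e l, κ + ε • d⟫ < h l := by
          apply hc.continuousAt.eventually_lt continuousAt_const
          simpa using hlt
        exact (this.filter_mono nhdsWithin_le_nhds).mono fun _ hx => hx.le
    obtain ⟨ε, hε, hpos⟩ := (hev.and self_mem_nhdsWithin).exists
    have h3 := h2 (κ + ε • d) hε
    rw [add_sub_cancel_left, real_inner_smul_right] at h3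
    have hpos' : (0 : ℝ) < ε := hpos
    exact nonpos_of_mul_nonpos_right h3 hpos'
  · rintro ⟨h1, h2⟩
    refine proj_eq_of h1 fun w hw => h2 _ fun j hj => ?_
    rw [inner_sub_right, mem_act.1 hj]
    linarith [hw j]

/-- A vector `d` orthogonal to all `e j` is an admissible test direction together with `-d`, so `y`
is orthogonal to it. -/
lemma normalCone_subset_span (J : Finset (Fin k)) {y : E} (hy : y ∈ normalCone e J) :
    y ∈ Submodule.span ℝ (e '' J) := by
  set V := Submodule.span ℝ (e '' J) with hV
  rw [← Submodule.orthogonal_orthogonal V, Submodule.mem_orthogonal]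
  intro d hd
  have hz : ∀ j ∈ J, ⟪e j, d⟫ = 0 := fun j hj =>
    (Submodule.mem_orthogonal _ _).1 hd _ (Submodule.subset_span ⟨j, hj, rfl⟩)
  have h1 := hy d fun j hj => (hz j hj).le
  have h2 := hy (-d) fun j hj => by rw [inner_neg_right, hz j hj, neg_zero]
  rw [inner_neg_right] at h2
  rw [real_inner_comm]
  linarith

/-- The event that `J` is active splits into a condition on `y` alone and one on `q` alone. All
points with active set `J` have the same component in `V`, and the residual of the projection lies
in `V`; so the projection must be that common component plus `q`. -/
lemma act_proj_add_eq_iff (hne : (poly e h).Nonempty) {J : Finset (Fin k)} {V : Submodule ℝ E}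
    (hV : V = Submodule.span ℝ (e '' J)) {κ₀ : E} (hκ₀ : act e h κ₀ = J) (y : V) (q : Vᗮ) :
    act e h (proj e h (y + q)) = J ↔
      ((y - V.orthogonalProjectionOnto κ₀ : V) : E) ∈ normalCone e J ∧
      (V.orthogonalProjectionOnto κ₀ + q : E) ∈ poly e h ∧
      act e h (V.orthogonalProjectionOnto κ₀ + q) = J := by
  set c : V := V.orthogonalProjectionOnto κ₀ with hc
  constructor
  · intro hJ
    obtain ⟨h1, h2⟩ := (proj_eq_iff hne (u := (y + q : E))).1 rfl
    set κ := proj e h (y + q : E) with hκ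
    rw [hJ] at h2
    have h3 : κ - κ₀ ∈ Vᗮ := by
      rw [Submodule.mem_orthogonal]
      intro v hv
      rw [hV] at hv
      induction hv using Submodule.span_induction with
      | mem x hx =>
        obtain ⟨j, hj, rfl⟩ := hx
        rw [inner_sub_right, mem_act.1 (hJ ▸ hj : j ∈ act e h κ),
          mem_act.1 (hκ₀ ▸ hj : j ∈ act e h κ₀), sub_self]
      | zero => simp
      | add x y _ _ hx hy => rw [inner_add_left, hx, hy, add_zero]
      | smul a x _ hx => rw [real_inner_smul_left, hx, mul_zero]
    have h4 : V.orthogonalProjectionOnto κ = c := by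
      rw [hc, ← sub_eq_zero, ← map_sub]
      exact Submodule.orthogonalProjectionOnto_apply_of_mem_orthogonal h3
    have h5 := normalCone_subset_span J h2
    rw [← hV] at h5
    have h6 : κ = c + q := by
      have h7 : κ - q ∈ V := by
        have : κ - q = y - (y + q - κ) := by abel
        rw [this]
        exact V.sub_mem y.2 h5
      have h8 : V.orthogonalProjectionOnto (κ - q) = ⟨κ - q, h7⟩ :=
        Submodule.orthogonalProjectionOnto_mem_subspace_eq_self ⟨κ - q, h7⟩
      rw [map_sub, Submodule.orthogonalProjectionOnto_apply_of_mem_orthogonal q.2,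
        sub_zero, h4] at h8
      rw [h8]
      simp
    rw [h6] at h1 h2 hJ
    refine ⟨?_, h1, hJ⟩
    convert h2 using 1
    push_cast
    abel
  · rintro ⟨h1, h2, h3⟩
    have : proj e h (y + q : E) = c + q := by
      rw [proj_eq_iff hne]
      refine ⟨h2, ?_⟩
      rw [h3]
      convert h1 using 1
      push_cast
      abel
    rw [this, h3]

lemma proj_add_eq (hne : (poly e h).Nonempty) {J : Finset (Fin k)} {V : Submodule ℝ E}
    (hV : V = Submodule.span ℝ (e '' J)) {κ₀ : E} (hκ₀ : act e h κ₀ = J) {y : V} {q : Vᗮ}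
    (H : act e h (proj e h (y + q)) = J) :
    proj e h (y + q) = V.orthogonalProjectionOnto κ₀ + q := by
  obtain ⟨h1, h2, h3⟩ := (act_proj_add_eq_iff hne hV hκ₀ y q).1 H
  rw [proj_eq_iff hne]
  refine ⟨h2, ?_⟩
  rw [h3]
  convert h1 using 1
  push_cast
  abel

end Finite

end Polyhedron

/-! ### The refined test for a standard Gaussian vector -/

section Canonical

open scoped ENNReal RealInnerProductSpace

variable {E : Type*} [NormedAddCommGroup E] [InnerProductSpace ℝ E] {k : ℕ}

/-- The nonzero vectors `e j`, `j ∈ J`, all point in the direction `v`, and there is one. -/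
structure IsRay (e : Fin k → E) (J : Finset (Fin k)) (v : E) : Prop where
  norm_eq_one : ‖v‖ = 1
  eq_smul : ∀ j ∈ J, e j = ‖e j‖ • v
  exists_ne_zero : ∃ j ∈ J, e j ≠ 0

open Classical in
/-- The distance from `κ` in direction `-v` up to which the facet through `κ` with normal `v`
remains the nearest one. -/
def zCrit (e : Fin k → E) (h : Fin k → ℝ) (κ v : E) : EReal :=
  ⨅ j, if ⟪e j, v⟫ = ‖e j‖ then ⊤ else
    (((h j - ⟪e j, κ⟫) / (‖e j‖ - ⟪e j, v⟫) : ℝ) : EReal)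

open Classical in
/-- The critical value of the refined test, as a function of the projection. -/
def crit (e : Fin k → E) (h : Fin k → ℝ) (α : ℝ) (κ : E) : ℝ :=
  if H : ∃ v, IsRay e (act e h κ) v then
    chiSqQuantile 1 (1 - 2 * α * stdNormalCDF (zCrit e h κ H.choose))
  else chiSqQuantile (Module.finrank ℝ (Submodule.span ℝ (e '' act e h κ))) (1 - α)

open Classical in
/-- The set of active constraints at the projection if it contains a nonzero one; otherwise the set
of nearest constraints. -/
def label (e : Fin k → E) (h : Fin k → ℝ) (u : E) : Finset (Fin k) :=
  if ∀ j ∈ act e h (proj e h u), e j = 0 then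
    Finset.univ.filter fun l => (e l = 0 ∧ h l = 0) ∨
      (e l ≠ 0 ∧ ∀ j, e j ≠ 0 → (h l - ⟪e l, u⟫) / ‖e l‖ ≤ (h j - ⟪e j, u⟫) / ‖e j‖)
  else act e h (proj e h u)

variable {e : Fin k → E} {h : Fin k → ℝ} {J : Finset (Fin k)}

lemma IsRay.unique {v w : E} (hv : IsRay e J v) (hw : IsRay e J w) : v = w := by
  obtain ⟨j, hj, hj0⟩ := hv.exists_ne_zero
  have h1 := (hv.eq_smul j hj).symm.trans (hw.eq_smul j hj)
  exact smul_right_injective E (norm_ne_zero_iff.2 hj0) h1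

lemma IsRay.inner_eq {v : E} (hv : IsRay e J v) {j : Fin k} (hj : j ∈ J) : ⟪e j, v⟫ = ‖e j‖ := by
  rw [hv.eq_smul j hj, real_inner_smul_left, real_inner_self_eq_norm_sq, hv.norm_eq_one, norm_smul,
    hv.norm_eq_one]
  simp

lemma inner_le_norm_of_unit {v : E} (hv : ‖v‖ = 1) (x : E) : ⟪x, v⟫ ≤ ‖x‖ := by
  simpa [hv] using real_inner_le_norm x v

lemma crit_eq_of_isRay {κ v : E} (hv : IsRay e (act e h κ) v) (α : ℝ) :
    crit e h α κ = chiSqQuantile 1 (1 - 2 * α * stdNormalCDF (zCrit e h κ v)) := by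
  have H : ∃ v, IsRay e (act e h κ) v := ⟨v, hv⟩
  rw [crit, dif_pos H, H.choose_spec.unique hv]

lemma crit_nonneg (α : ℝ) (κ : E) : 0 ≤ crit e h α κ := by
  unfold crit
  split_ifs <;> exact chiSqQuantile_nonneg _ _

lemma lt_zCrit_iff {κ v : E} (hv : ‖v‖ = 1) (t : ℝ) :
    (t : EReal) < zCrit e h κ v ↔
      ∀ j, ⟪e j, v⟫ ≠ ‖e j‖ → t * (‖e j‖ - ⟪e j, v⟫) < h j - ⟪e j, κ⟫ := by
  rw [zCrit, ← Finset.inf_univ_eq_iInf, Finset.lt_inf_iff (EReal.coe_lt_top t)]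
  simp only [Finset.mem_univ, true_implies]
  refine forall_congr' fun j => ?_
  by_cases hj : ⟪e j, v⟫ = ‖e j‖
  · simp [hj]
  · have : 0 < ‖e j‖ - ⟪e j, v⟫ :=
      sub_pos.2 (lt_of_le_of_ne (inner_le_norm_of_unit hv _) hj)
    rw [if_neg hj, EReal.coe_lt_coe_iff, lt_div_iff₀ this]
    exact ⟨fun h _ => h, fun h => h hj⟩

lemma zCrit_nonneg {κ v : E} (hv : ‖v‖ = 1) (hκ : κ ∈ poly e h) : 0 ≤ zCrit e h κ v := by
  refine le_iInf fun j => ?_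
  split_ifs with hj
  · exact le_top
  · exact_mod_cast div_nonneg (sub_nonneg.2 (hκ j)) (sub_nonneg.2 (inner_le_norm_of_unit hv _))

/-- Active rows are positive multiples of `v` or zero and contribute `⊤`; each of the finitely many
remaining constraints has strict slack. -/
lemma zCrit_pos {κ v : E} (hv : IsRay e (act e h κ) v) (hκ : κ ∈ poly e h) :
    0 < zCrit e h κ v := by
  have := (lt_zCrit_iff (e := e) (h := h) (κ := κ) hv.norm_eq_one 0).2 fun j hj => by
    rw [zero_mul, sub_pos]
    exact lt_of_le_of_ne (hκ j) fun h => hj (hv.inner_eq (mem_act.2 h))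
  exact_mod_cast this

lemma normalCone_eq_zero (hJ : ∀ j ∈ J, e j = 0) {y : E} (hy : y ∈ normalCone e J) : y = 0 := by
  have := hy y fun j hj => by simp [hJ j hj]
  exact inner_self_eq_zero.1 (le_antisymm this real_inner_self_nonneg)

lemma label_eq_act {u : E} (H : ∃ j ∈ act e h (proj e h u), e j ≠ 0) :
    label e h u = act e h (proj e h u) := by
  rw [label, if_neg]
  push Not
  exact H

lemma mem_label_of_interior {u : E} (H : ∀ j ∈ act e h (proj e h u), e j = 0) (l : Fin k) :
    l ∈ label e h u ↔ (e l = 0 ∧ h l = 0) ∨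
      (e l ≠ 0 ∧ ∀ j, e j ≠ 0 → (h l - ⟪e l, u⟫) / ‖e l‖ ≤ (h j - ⟪e j, u⟫) / ‖e j‖) := by
  rw [label, if_pos H]
  simp

section Finite

variable [FiniteDimensional ℝ E]

lemma mem_normalCone_of_isRay {v : E} (hv : IsRay e J v) {y : E} :
    y ∈ normalCone e J ↔ ∃ s : ℝ, 0 ≤ s ∧ y = s • v := by
  constructor
  · intro hy
    have h1 : y ∈ Submodule.span ℝ {v} := by
      refine Submodule.span_le.2 ?_ (normalCone_subset_span J hy)
      rintro _ ⟨j, hj, rfl⟩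
      rw [hv.eq_smul j hj]
      exact Submodule.smul_mem _ _ (Submodule.mem_span_singleton_self v)
    obtain ⟨s, rfl⟩ := Submodule.mem_span_singleton.1 h1
    refine ⟨s, ?_, rfl⟩
    have h2 := hy (-v) fun j hj => by
      rw [inner_neg_right, hv.inner_eq hj]
      exact neg_nonpos.2 (norm_nonneg _)
    rw [inner_neg_right, real_inner_smul_left, real_inner_self_eq_norm_sq, hv.norm_eq_one] at h2
    linarith
  · rintro ⟨s, hs, rfl⟩ d hd
    obtain ⟨j, hj, hj0⟩ := hv.exists_ne_zero
    have h1 := hd j hj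
    rw [hv.eq_smul j hj, real_inner_smul_left] at h1
    rw [real_inner_smul_left]
    exact mul_nonpos_of_nonneg_of_nonpos hs
      (nonpos_of_mul_nonpos_right h1 (norm_pos_iff.2 hj0))

lemma proj_eq_self (hne : (poly e h).Nonempty) {u : E}
    (H : ∀ j ∈ act e h (proj e h u), e j = 0) : proj e h u = u := by
  have := ((proj_eq_iff hne (u := u)).1 rfl).2
  exact (sub_eq_zero.1 (normalCone_eq_zero H this)).symm

/-! ### Lines parallel to the common normal direction -/

section Slice

variable {v : E} {i : Fin k} {q : E}

/-- On a line in direction `v` the projection onto the facet is the fixed point with coordinate `h i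
/ ‖e i‖`, and the residual must be a nonnegative multiple of `v`. -/
lemma act_proj_line_iff (hne : (poly e h).Nonempty) (hv : IsRay e J v) (hi : i ∈ J)
    (hi0 : e i ≠ 0) (hq : ⟪v, q⟫ = 0) (t : ℝ) :
    act e h (proj e h (t • v + q)) = J ↔
      h i / ‖e i‖ ≤ t ∧ (h i / ‖e i‖) • v + q ∈ poly e h ∧
        act e h ((h i / ‖e i‖) • v + q) = J := by
  have hn : ‖e i‖ ≠ 0 := norm_ne_zero_iff.2 hi0
  constructor
  · intro hJ
    obtain ⟨h1, h2⟩ := (proj_eq_iff hne (u := t • v + q)).1 rfl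
    rw [hJ, mem_normalCone_of_isRay hv] at h2
    obtain ⟨s, hs, h3⟩ := h2
    have h4 : proj e h (t • v + q) = (t - s) • v + q := by
      rw [sub_smul, ← h3]; abel
    rw [h4] at h1 hJ
    have h5 : ⟪e i, (t - s) • v + q⟫ = h i := mem_act.1 (hJ ▸ hi)
    have h6 : ⟪e i, q⟫ = 0 := by
      rw [hv.eq_smul i hi, real_inner_smul_left, hq, mul_zero]
    rw [inner_add_right, real_inner_smul_right, hv.inner_eq hi, h6, add_zero] at h5
    have h7 : h i / ‖e i‖ = t - s := by
      rw [← h5]; field_simp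
    rw [h7]
    exact ⟨by linarith, h1, hJ⟩
  · rintro ⟨h1, h2, h3⟩
    have : proj e h (t • v + q) = (h i / ‖e i‖) • v + q := by
      rw [proj_eq_iff hne, h3, mem_normalCone_of_isRay hv]
      refine ⟨h2, t - h i / ‖e i‖, by linarith, ?_⟩
      rw [sub_smul]; abel
    rw [this, h3]

lemma proj_line_eq (hne : (poly e h).Nonempty) (hv : IsRay e J v) (hi : i ∈ J)
    (hi0 : e i ≠ 0) (hq : ⟪v, q⟫ = 0) {t : ℝ}
    (H : act e h (proj e h (t • v + q)) = J) :
    proj e h (t • v + q) = (h i / ‖e i‖) • v + q := by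
  obtain ⟨h1, h2, h3⟩ := (act_proj_line_iff hne hv hi hi0 hq t).1 H
  rw [proj_eq_iff hne, h3, mem_normalCone_of_isRay hv]
  refine ⟨h2, t - h i / ‖e i‖, by linarith, ?_⟩
  rw [sub_smul]; abel

/-- Let `κ` be the facet point on the line and `τ = h i / ‖e i‖ - t` the depth below it. If `τ ≤ 0`
the point projects to `κ`, and `zCrit` is positive. If `τ > 0`, constraint `j` has slack `h j - ⟪e
j, κ⟫ + τ ⟪e j, v⟫`, which exceeds `τ ‖e j‖` exactly when `τ` is below the `j`-th term of `zCrit`;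
so `J` remains nearest up to depth `zCrit`. Zero rows with zero right-hand side are active
everywhere, which is why labels include them. -/
lemma label_line_iff (hne : (poly e h).Nonempty) (hv : IsRay e J v) (hi : i ∈ J)
    (hi0 : e i ≠ 0) (hq : ⟪v, q⟫ = 0) (t : ℝ) :
    label e h (t • v + q) = J ↔
      ((h i / ‖e i‖) • v + q ∈ poly e h ∧ act e h ((h i / ‖e i‖) • v + q) = J) ∧
        ((h i / ‖e i‖ - t : ℝ) : EReal) < zCrit e h ((h i / ‖e i‖) • v + q) v := by
  set η := h i / ‖e i‖ with hη
  set κ := η • v + q with hκ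
  set u := t • v + q with hu
  have hn : 0 < ‖e i‖ := norm_pos_iff.2 hi0
  have hκu : ∀ j, ⟪e j, κ⟫ = ⟪e j, u⟫ + (η - t) * ⟪e j, v⟫ := fun j => by
    rw [← real_inner_smul_right, ← inner_add_right, sub_smul, hκ, hu]
    congr 1; abel
  have hiκ : ⟪e i, κ⟫ = h i := by
    have h6 : ⟪e i, q⟫ = 0 := by
      rw [hv.eq_smul i hi, real_inner_smul_left, hq, mul_zero]
    rw [hκ, inner_add_right, real_inner_smul_right, hv.inner_eq hi, h6, add_zero, hη]
    field_simp
  have hri : (h i - ⟪e i, u⟫) / ‖e i‖ = η - t := by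
    rw [div_eq_iff hn.ne']
    have := hκu i
    rw [hiκ, hv.inner_eq hi] at this
    linarith
  constructor
  · intro hJ
    by_cases H : ∀ j ∈ act e h (proj e h u), e j = 0
    · have hpu := proj_eq_self hne H
      have hup : u ∈ poly e h := hpu ▸ (proj_spec hne u).1
      have hm := mem_label_of_interior H
      rw [hJ] at hm
      have hiM : ∀ j, e j ≠ 0 → η - t ≤ (h j - ⟪e j, u⟫) / ‖e j‖ := by
        have := (hm i).1 hi
        rw [hri] at this
        rcases this with h1 | h1
        · exact absurd h1.1 hi0
        · exact h1.2
      have hτ : 0 ≤ η - t := by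
        rw [← hri]
        exact div_nonneg (sub_nonneg.2 (hup i)) (norm_nonneg _)
      -- A nonzero row outside `J` is strictly farther than some other row; it is then also farther
      -- than row `i`, which attains the minimum.
      have hout : ∀ j, j ∉ J → e j ≠ 0 → (η - t) * ‖e j‖ < h j - ⟪e j, u⟫ := by
        intro j hj hj0
        have h1 := mt (hm j).2 hj
        push Not at h1
        obtain ⟨j', hj'0, hj'⟩ := h1.2 hj0
        have h2 := (hiM j' hj'0).trans_lt hj'
        exact (lt_div_iff₀ (norm_pos_iff.2 hj0)).1 h2
      have hin : ∀ j ∈ J, ⟪e j, κ⟫ = h j := by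
        intro j hj
        rcases (hm j).1 hj with h1 | h1
        · rw [h1.1, h1.2, inner_zero_left]
        · have h2 : (h j - ⟪e j, u⟫) / ‖e j‖ = η - t :=
            le_antisymm (hri ▸ h1.2 i hi0) (hiM j h1.1)
          rw [div_eq_iff (norm_ne_zero_iff.2 h1.1)] at h2
          rw [hκu, hv.inner_eq hj]
          linarith
      have hout' : ∀ j, j ∉ J → ⟪e j, κ⟫ < h j := by
        intro j hj
        by_cases hj0 : e j = 0
        · have h1 := hup j
          have h2 := mt (hm j).2 hj
          push Not at h2
          have h3 := h2.1 hj0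
          rw [hj0, inner_zero_left] at h1 ⊢
          exact lt_of_le_of_ne h1 h3.symm
        · have h1 := hout j hj hj0
          have h2 := mul_le_mul_of_nonneg_left (inner_le_norm_of_unit hv.norm_eq_one (e j)) hτ
          rw [hκu]
          linarith
      refine ⟨⟨fun j => ?_, ?_⟩, ?_⟩
      · by_cases hj : j ∈ J
        · exact (hin j hj).le
        · exact (hout' j hj).le
      · ext j
        rw [mem_act]
        exact ⟨fun hh => by_contra fun hj => (hout' j hj).ne hh, hin j⟩
      · rw [lt_zCrit_iff hv.norm_eq_one]
        intro j hj
        have hjJ : j ∉ J := fun hh => hj (hv.inner_eq hh)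
        have hj0 : e j ≠ 0 := by
          rintro h0
          simp [h0] at hj
        have := hout j hjJ hj0
        rw [hκu]
        linarith
    · push Not at H
      rw [label_eq_act H] at hJ
      obtain ⟨h1, h2, h3⟩ := (act_proj_line_iff hne hv hi hi0 hq t).1 hJ
      refine ⟨⟨h2, h3⟩, lt_of_le_of_lt ?_ (zCrit_pos (h3.symm ▸ hv) h2)⟩
      exact_mod_cast sub_nonpos.2 h1
  · rintro ⟨⟨h1, h2⟩, h3⟩
    rcases le_or_gt η t with ht | ht
    · have h4 := (act_proj_line_iff hne hv hi hi0 hq t).2 ⟨ht, h1, h2⟩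
      rw [label_eq_act, h4]
      exact ⟨i, h4 ▸ hi, hi0⟩
    · rw [lt_zCrit_iff hv.norm_eq_one] at h3
      have hτ : 0 < η - t := sub_pos.2 ht
      have hin : ∀ j ∈ J, h j - ⟪e j, u⟫ = (η - t) * ‖e j‖ := by
        intro j hj
        have h4 := hκu j
        rw [mem_act.1 (h2 ▸ hj : j ∈ act e h κ), hv.inner_eq hj] at h4
        linarith
      have hout : ∀ j, j ∉ J → (η - t) * ‖e j‖ < h j - ⟪e j, u⟫ := by
        intro j hj
        have h4 := hκu j
        have h5 : ⟪e j, κ⟫ < h j := lt_of_le_of_ne (h1 j) fun hh => hj (h2 ▸ mem_act.2 hh)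
        by_cases hj' : ⟪e j, v⟫ = ‖e j‖
        · rw [hj'] at h4
          linarith
        · have := h3 j hj'
          linarith
      have hup : u ∈ poly e h := by
        intro j
        have h5 : 0 ≤ (η - t) * ‖e j‖ := by positivity
        by_cases hj : j ∈ J
        · linarith [hin j hj]
        · linarith [hout j hj]
      have hpu : proj e h u = u := proj_eq_of hup fun w _ => by simp
      have H : ∀ j ∈ act e h (proj e h u), e j = 0 := by
        intro j hj
        rw [hpu, mem_act] at hj
        by_contra hj0
        have h5 : 0 < (η - t) * ‖e j‖ := mul_pos hτ (norm_pos_iff.2 hj0)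
        by_cases hjJ : j ∈ J
        · linarith [hin j hjJ]
        · linarith [hout j hjJ]
      have hge : ∀ j, e j ≠ 0 → η - t ≤ (h j - ⟪e j, u⟫) / ‖e j‖ := by
        intro j hj0
        rw [le_div_iff₀ (norm_pos_iff.2 hj0)]
        by_cases hjJ : j ∈ J
        · exact (hin j hjJ).ge
        · exact (hout j hjJ).le
      ext j
      rw [mem_label_of_interior H]
      constructor
      · rintro (⟨h5, h6⟩ | ⟨h5, h6⟩)
        · rw [← h2, mem_act, h5, h6, inner_zero_left]
        · by_contra hj
          have h7 := h6 i hi0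
          rw [hri, div_le_iff₀ (norm_pos_iff.2 h5)] at h7
          linarith [hout j hj]
      · intro hj
        by_cases hj0 : e j = 0
        · left
          refine ⟨hj0, ?_⟩
          have := hin j hj
          rw [hj0] at this
          simpa using this
        · right
          refine ⟨hj0, fun l hl => ?_⟩
          rw [hin j hj, mul_div_cancel_right₀ _ (norm_ne_zero_iff.2 hj0)]
          exact hge l hl

end Slice

end Finite

end Canonical

/-! ### Rejection probability of the refined test under the standard Gaussian law -/

section Size

open scoped ENNReal RealInnerProductSpace

variable {E : Type*} [NormedAddCommGroup E] [InnerProductSpace ℝ E] [FiniteDimensional ℝ E]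
  [MeasurableSpace E] [BorelSpace E] {k : ℕ} {e : Fin k → E} {h : Fin k → ℝ} {J : Finset (Fin k)}

lemma measurableSet_finset_eq {X : Type*} [MeasurableSpace X] {f : X → Finset (Fin k)}
    (hf : ∀ l, MeasurableSet {x | l ∈ f x}) (J : Finset (Fin k)) :
    MeasurableSet {x | f x = J} := by
  have : {x | f x = J} = ⋂ l, {x | l ∈ f x ↔ l ∈ J} := by
    ext x
    simp [Finset.ext_iff]
  rw [this]
  refine MeasurableSet.iInter fun l => ?_
  by_cases hl : l ∈ J
  · simpa [hl] using hf l
  · simp only [hl, iff_false]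
    exact (hf l).compl

lemma measurable_proj (hne : (poly e h).Nonempty) : Measurable (proj e h) :=
  (continuous_proj hne).measurable

lemma measurableSet_mem_act (hne : (poly e h).Nonempty) (l : Fin k) :
    MeasurableSet {u | l ∈ act e h (proj e h u)} := by
  have := measurable_proj hne
  simp only [mem_act]
  exact measurableSet_eq_fun (by fun_prop) measurable_const

lemma measurableSet_act_eq (hne : (poly e h).Nonempty) (J : Finset (Fin k)) :
    MeasurableSet {u | act e h (proj e h u) = J} :=
  measurableSet_finset_eq (measurableSet_mem_act hne) J

lemma measurableSet_label_eq (hne : (poly e h).Nonempty) (J : Finset (Fin k)) :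
    MeasurableSet {u | label e h u = J} := by
  refine measurableSet_finset_eq (fun l => ?_) J
  have hI : MeasurableSet {u | ∀ j ∈ act e h (proj e h u), e j = 0} := by
    have : {u | ∀ j ∈ act e h (proj e h u), e j = 0} =
        ⋂ j, ⋂ (_ : e j ≠ 0), {u | j ∈ act e h (proj e h u)}ᶜ := by
      ext u
      simp only [Set.mem_ofPred_eq, Set.mem_iInter, Set.mem_compl_iff]
      exact forall_congr' fun j => ⟨fun a b c => b (a c), fun a b => by_contra fun c => a c b⟩
    rw [this]
    exact MeasurableSet.iInter fun j => MeasurableSet.iInter fun _ =>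
      (measurableSet_mem_act hne j).compl
  have hM : MeasurableSet {u : E | (e l = 0 ∧ h l = 0) ∨ (e l ≠ 0 ∧
      ∀ j, e j ≠ 0 → (h l - ⟪e l, u⟫) / ‖e l‖ ≤ (h j - ⟪e j, u⟫) / ‖e j‖)} := by
    have : {u : E | ∀ j, e j ≠ 0 → (h l - ⟪e l, u⟫) / ‖e l‖ ≤ (h j - ⟪e j, u⟫) / ‖e j‖} =
        ⋂ j, ⋂ (_ : e j ≠ 0), {u | (h l - ⟪e l, u⟫) / ‖e l‖ ≤ (h j - ⟪e j, u⟫) / ‖e j‖} := by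
      ext u
      simp
    have hms : MeasurableSet {u : E | ∀ j, e j ≠ 0 →
        (h l - ⟪e l, u⟫) / ‖e l‖ ≤ (h j - ⟪e j, u⟫) / ‖e j‖} := by
      rw [this]
      exact MeasurableSet.iInter fun j => MeasurableSet.iInter fun _ =>
        measurableSet_le (by fun_prop) (by fun_prop)
    exact (MeasurableSet.const _).union ((MeasurableSet.const _).inter hms)
  have : {u | l ∈ label e h u} = ({u | ∀ j ∈ act e h (proj e h u), e j = 0} ∩
      {u : E | (e l = 0 ∧ h l = 0) ∨ (e l ≠ 0 ∧
        ∀ j, e j ≠ 0 → (h l - ⟪e l, u⟫) / ‖e l‖ ≤ (h j - ⟪e j, u⟫) / ‖e j‖)}) ∪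
      ({u | ∀ j ∈ act e h (proj e h u), e j = 0}ᶜ ∩ {u | l ∈ act e h (proj e h u)}) := by
    ext u
    by_cases H : ∀ j ∈ act e h (proj e h u), e j = 0
    · have h1 : u ∈ {u | ∀ j ∈ act e h (proj e h u), e j = 0} := H
      have h2 := mem_label_of_interior H l
      simp only [Set.mem_union, Set.mem_inter_iff, Set.mem_compl_iff, h1, not_true, false_and,
        or_false, true_and]
      exact h2
    · have h1 : u ∉ {u | ∀ j ∈ act e h (proj e h u), e j = 0} := H
      have h2 : label e h u = act e h (proj e h u) := label_eq_act (by push Not at H; exact H)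
      simp only [Set.mem_union, Set.mem_inter_iff, Set.mem_compl_iff, h1, not_false_iff, false_and,
        false_or, true_and, Set.mem_ofPred_eq, h2]
  rw [this]
  exact (hI.inter hM).union (hI.compl.inter (measurableSet_mem_act hne l))

/-- The rejection event on the part of the space where `J` is the active set. -/
def rejOn (e : Fin k → E) (h : Fin k → ℝ) (α : ℝ) (J : Finset (Fin k)) : Set E :=
  {u | act e h (proj e h u) = J ∧ crit e h α (proj e h u) < ‖u - proj e h u‖ ^ 2}

lemma measurable_zCrit {X : Type*} [MeasurableSpace X] {f : X → E} (hf : Measurable f) (v : E) :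
    Measurable fun x => zCrit e h (f x) v := by
  unfold zCrit
  refine Measurable.iInf fun j => ?_
  split_ifs
  · exact measurable_const
  · exact measurable_coe_real_ereal.comp (by fun_prop)

lemma measurableSet_chiSqQuantile_lt {X : Type*} [MeasurableSpace X] (r : ℕ) {q T : X → ℝ}
    (hq : Measurable q) (hT : Measurable T) (hq1 : ∀ x, q x < 1) :
    MeasurableSet {x | chiSqQuantile r (q x) < T x} := by
  have : {x | chiSqQuantile r (q x) < T x} = ⋃ y : ℚ, {x | 0 ≤ (y : ℝ) ∧ (y : ℝ) < T x ∧
      q x ≤ (chiSq r).real (Set.Iic (y : ℝ))} := by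
    ext x
    simp only [Set.mem_ofPred_eq, Set.mem_iUnion]
    exact chiSqQuantile_lt_iff r (hq1 x) _
  rw [this]
  exact MeasurableSet.iUnion fun y => (MeasurableSet.const _).inter
    ((measurableSet_lt measurable_const hT).inter (measurableSet_le hq measurable_const))

/-- Fixing `J` fixes the case in `crit` and the direction `v`, so the critical value depends on the
projection only through `zCrit`, or not at all. -/
lemma measurableSet_rejOn (hne : (poly e h).Nonempty) {α : ℝ} (hα : 0 < α) (J : Finset (Fin k)) :
    MeasurableSet (rejOn e h α J) := by
  have hp := measurable_proj hne
  have hA := measurableSet_act_eq hne J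
  by_cases hray : ∃ v, IsRay e J v
  · obtain ⟨v, hv⟩ := hray
    have : rejOn e h α J = {u | act e h (proj e h u) = J} ∩
        {u | chiSqQuantile 1 (1 - 2 * α * stdNormalCDF (zCrit e h (proj e h u) v)) <
          ‖u - proj e h u‖ ^ 2} := by
      ext u
      refine and_congr_right fun hu => ?_
      rw [crit_eq_of_isRay (hu.symm ▸ hv)]
      rfl
    rw [this]
    refine hA.inter (measurableSet_chiSqQuantile_lt 1 ?_ (by fun_prop) fun u => ?_)
    · exact measurable_const.sub (measurable_const.mul
        (stdNormalCDF_mono.measurable.comp (measurable_zCrit hp v)))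
    · have := half_le_stdNormalCDF (zCrit_nonneg hv.norm_eq_one (proj_spec hne u).1)
      have : 0 < 2 * α * stdNormalCDF (zCrit e h (proj e h u) v) := by positivity
      linarith
  · have : rejOn e h α J = {u | act e h (proj e h u) = J} ∩
        {u | chiSqQuantile (Module.finrank ℝ (Submodule.span ℝ (e '' J))) (1 - α) <
          ‖u - proj e h u‖ ^ 2} := by
      ext u
      refine and_congr_right fun hu => ?_
      rw [crit, dif_neg (by rwa [hu]), hu]
      rfl
    rw [this]
    exact hA.inter (measurableSet_lt measurable_const (by fun_prop))

lemma stdGaussian_eq_lintegral_line {v : E} (hv : ‖v‖ = 1) {A : Set E} (hA : MeasurableSet A) :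
    stdGaussian E A = ∫⁻ q : (ℝ ∙ v)ᗮ, gaussianReal 0 1 {t : ℝ | t • v + (q : E) ∈ A}
      ∂(stdGaussian (ℝ ∙ v)ᗮ) := by
  rw [← lintegral_indicator_one hA, lintegral_stdGaussian_line hv (measurable_one.indicator hA)]
  congr 1
  ext q
  have hm : MeasurableSet {t : ℝ | t • v + (q : E) ∈ A} :=
    (by fun_prop : Measurable fun t : ℝ => t • v + (q : E)) hA
  rw [← lintegral_indicator_one hm]
  rfl

lemma stdGaussian_eq_lintegral_submodule (V : Submodule ℝ E) {A : Set E} (hA : MeasurableSet A) :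
    stdGaussian E A = ∫⁻ q : Vᗮ, stdGaussian V {y : V | (y : E) + (q : E) ∈ A}
      ∂(stdGaussian Vᗮ) := by
  rw [← lintegral_indicator_one hA,
    lintegral_stdGaussian_submodule V (measurable_one.indicator hA)]
  congr 1
  ext q
  have hm : MeasurableSet {y : V | (y : E) + (q : E) ∈ A} :=
    (by fun_prop : Measurable fun y : V => (y : E) + (q : E)) hA
  rw [← lintegral_indicator_one hm]
  rfl

/-! ### Active rows with a single direction -/

section Ray

variable {v : E} {i : Fin k} {α : ℝ}

omit [MeasurableSpace E] [BorelSpace E] in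
lemma rejOn_line_slice (hne : (poly e h).Nonempty) (hv : IsRay e J v) (hi : i ∈ J)
    (hi0 : e i ≠ 0) {q : E} (hq : ⟪v, q⟫ = 0)
    (hκ : (h i / ‖e i‖) • v + q ∈ poly e h ∧ act e h ((h i / ‖e i‖) • v + q) = J) :
    {t : ℝ | t • v + q ∈ rejOn e h α J} =
      {t | Real.sqrt (chiSqQuantile 1 (1 - 2 * α * stdNormalCDF
        (zCrit e h ((h i / ‖e i‖) • v + q) v))) < t - h i / ‖e i‖} := by
  ext t
  set s := chiSqQuantile 1 (1 - 2 * α * stdNormalCDF (zCrit e h ((h i / ‖e i‖) • v + q) v))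
  have hs : 0 ≤ s := chiSqQuantile_nonneg _ _
  have key : act e h (proj e h (t • v + q)) = J →
      (crit e h α (proj e h (t • v + q)) < ‖t • v + q - proj e h (t • v + q)‖ ^ 2 ↔
        s < (t - h i / ‖e i‖) ^ 2) := by
    intro h1
    rw [proj_line_eq hne hv hi hi0 hq h1, crit_eq_of_isRay (hκ.2.symm ▸ hv),
      show t • v + q - ((h i / ‖e i‖) • v + q) = (t - h i / ‖e i‖) • v by rw [sub_smul]; abel,
      norm_smul, hv.norm_eq_one, mul_one, Real.norm_eq_abs, sq_abs]
  change (_ ∧ _) ↔ Real.sqrt s < _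
  constructor
  · rintro ⟨h1, h2⟩
    have h3 := ((act_proj_line_iff hne hv hi hi0 hq t).1 h1).1
    rw [key h1] at h2
    have h4 : 0 < t - h i / ‖e i‖ := by
      refine lt_of_le_of_ne (by linarith) fun h0 => ?_
      rw [← h0] at h2
      norm_num at h2
      linarith
    exact (Real.sqrt_lt' h4).2 h2
  · intro h1
    have h0 := Real.sqrt_nonneg s
    have h2 := (act_proj_line_iff hne hv hi hi0 hq t).2 ⟨by linarith, hκ⟩
    refine ⟨h2, (key h2).2 ?_⟩
    rw [← Real.sq_sqrt hs]
    gcongr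

omit [MeasurableSpace E] [BorelSpace E] in
lemma rejOn_line_slice_empty (hne : (poly e h).Nonempty) (hv : IsRay e J v) (hi : i ∈ J)
    (hi0 : e i ≠ 0) {q : E} (hq : ⟪v, q⟫ = 0)
    (hκ : ¬ ((h i / ‖e i‖) • v + q ∈ poly e h ∧ act e h ((h i / ‖e i‖) • v + q) = J)) :
    {t : ℝ | t • v + q ∈ rejOn e h α J} = ∅ := by
  ext t
  simp only [Set.mem_ofPred_eq, Set.mem_empty_iff_false, iff_false]
  exact fun h1 => hκ ((act_proj_line_iff hne hv hi hi0 hq t).1 h1.1).2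

/-- Integrate the one-dimensional comparison over the lines parallel to `v`; the shift is `h i / ‖e
i‖`, nonnegative because the origin is feasible. The bound uses the label cell, not just the event
that `J` is active. -/
lemma stdGaussian_rejOn_le_of_isRay (hh : ∀ l, 0 ≤ h l) (hα : 0 < α) (hα1 : α ≤ 1)
    (hne : (poly e h).Nonempty) (hv : IsRay e J v) :
    stdGaussian E (rejOn e h α J) ≤ ENNReal.ofReal α * stdGaussian E {u | label e h u = J} := by
  obtain ⟨i, hi, hi0⟩ := hv.exists_ne_zero
  rw [stdGaussian_eq_lintegral_line hv.norm_eq_one (measurableSet_rejOn hne hα J),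
    stdGaussian_eq_lintegral_line hv.norm_eq_one (measurableSet_label_eq hne J),
    ← lintegral_const_mul' _ _ ENNReal.ofReal_ne_top]
  refine lintegral_mono fun q => ?_
  have hq : ⟪v, (q : E)⟫ = 0 := Submodule.mem_orthogonal_singleton_iff_inner_right.1 q.2
  by_cases hκ : (h i / ‖e i‖) • v + (q : E) ∈ poly e h ∧
      act e h ((h i / ‖e i‖) • v + (q : E)) = J
  · simp only [rejOn_line_slice hne hv hi hi0 hq hκ, Set.mem_ofPred_eq,
      label_line_iff hne hv hi hi0 hq, hκ, true_and, and_self]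
    exact gaussianReal_shift_tail_le hα hα1 (zCrit_nonneg hv.norm_eq_one hκ.1)
      (div_nonneg (hh i) (norm_nonneg _))
  · simp only [rejOn_line_slice_empty hne hv hi hi0 hq hκ, measure_empty, zero_le]

lemma stdGaussian_rejOn_eq_of_isRay (hh : ∀ l, h l = 0) (hα : 0 < α) (hα1 : α ≤ 1 / 2)
    (hne : (poly e h).Nonempty) (hv : IsRay e J v) :
    stdGaussian E (rejOn e h α J) = ENNReal.ofReal α * stdGaussian E {u | label e h u = J} := by
  obtain ⟨i, hi, hi0⟩ := hv.exists_ne_zero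
  rw [stdGaussian_eq_lintegral_line hv.norm_eq_one (measurableSet_rejOn hne hα J),
    stdGaussian_eq_lintegral_line hv.norm_eq_one (measurableSet_label_eq hne J),
    ← lintegral_const_mul' _ _ ENNReal.ofReal_ne_top]
  refine lintegral_congr fun q => ?_
  have hq : ⟪v, (q : E)⟫ = 0 := Submodule.mem_orthogonal_singleton_iff_inner_right.1 q.2
  by_cases hκ : (h i / ‖e i‖) • v + (q : E) ∈ poly e h ∧
      act e h ((h i / ‖e i‖) • v + (q : E)) = J
  · have h0 : h i / ‖e i‖ = 0 := by rw [hh i, zero_div]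
    have := gaussianReal_sqrt_quantile_lt_eq hα hα1 (zCrit_nonneg hv.norm_eq_one hκ.1)
    simp only [rejOn_line_slice hne hv hi hi0 hq hκ, Set.mem_ofPred_eq,
      label_line_iff hne hv hi hi0 hq, hκ, true_and, and_self]
    simpa only [h0, sub_zero, zero_sub] using this
  · simp only [rejOn_line_slice_empty hne hv hi hi0 hq hκ, measure_empty, Set.mem_ofPred_eq,
      label_line_iff hne hv hi hi0 hq, hκ, false_and]
    simp

end Ray

/-! ### Remaining active sets and summation over all of them -/

section General

variable {α : ℝ}

omit [FiniteDimensional ℝ E] [MeasurableSpace E] [BorelSpace E] in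
lemma crit_eq_of_not_isRay {κ : E} (hray : ¬ ∃ v, IsRay e (act e h κ) v) (α : ℝ) :
    crit e h α κ =
      chiSqQuantile (Module.finrank ℝ (Submodule.span ℝ (e '' act e h κ))) (1 - α) := by
  rw [crit, dif_neg hray]

omit [MeasurableSpace E] [BorelSpace E] in
/-- The slices of the event that `J` is active and of the corresponding rejection event. -/
lemma rejOn_submodule_slice (hne : (poly e h).Nonempty) (hray : ¬ ∃ v, IsRay e J v)
    {V : Submodule ℝ E} (hV : V = Submodule.span ℝ (e '' J)) {κ₀ : E} (hκ₀ : act e h κ₀ = J)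
    {q : Vᗮ} (hq : (V.orthogonalProjectionOnto κ₀ : E) + q ∈ poly e h ∧
      act e h (V.orthogonalProjectionOnto κ₀ + q) = J) :
    {y : V | (y : E) + (q : E) ∈ rejOn e h α J} =
      {y : V | y - V.orthogonalProjectionOnto κ₀ ∈ (Subtype.val ⁻¹' normalCone e J : Set V) ∧
        chiSqQuantile (Module.finrank ℝ V) (1 - α) < ‖y - V.orthogonalProjectionOnto κ₀‖ ^ 2} := by
  ext y
  have key : act e h (proj e h (y + q)) = J →
      (crit e h α (proj e h (y + q)) < ‖(y : E) + q - proj e h (y + q)‖ ^ 2 ↔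
        chiSqQuantile (Module.finrank ℝ V) (1 - α) <
          ‖y - V.orthogonalProjectionOnto κ₀‖ ^ 2) := by
    intro h1
    rw [crit_eq_of_not_isRay (by rwa [h1]), h1, ← hV, proj_add_eq hne hV hκ₀ h1,
      add_sub_add_right_eq_sub, ← Submodule.coe_sub, Submodule.coe_norm]
  constructor
  · rintro ⟨h1, h2⟩
    exact ⟨((act_proj_add_eq_iff hne hV hκ₀ y q).1 h1).1, (key h1).1 h2⟩
  · rintro ⟨h1, h2⟩
    have h3 := (act_proj_add_eq_iff hne hV hκ₀ y q).2 ⟨h1, hq⟩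
    exact ⟨h3, (key h3).2 h2⟩

omit [MeasurableSpace E] [BorelSpace E] in
lemma act_submodule_slice (hne : (poly e h).Nonempty)
    {V : Submodule ℝ E} (hV : V = Submodule.span ℝ (e '' J)) {κ₀ : E} (hκ₀ : act e h κ₀ = J)
    {q : Vᗮ} (hq : (V.orthogonalProjectionOnto κ₀ : E) + q ∈ poly e h ∧
      act e h (V.orthogonalProjectionOnto κ₀ + q) = J) :
    {y : V | act e h (proj e h ((y : E) + (q : E))) = J} =
      {y : V | y - V.orthogonalProjectionOnto κ₀ ∈ (Subtype.val ⁻¹' normalCone e J : Set V)} := by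
  ext y
  exact (act_proj_add_eq_iff hne hV hκ₀ y q).trans ⟨fun h => h.1, fun h => ⟨h, hq⟩⟩

omit [FiniteDimensional ℝ E] [MeasurableSpace E] [BorelSpace E] in
lemma nontrivial_span (hJ : ∃ j ∈ J, e j ≠ 0) : Nontrivial (Submodule.span ℝ (e '' J)) := by
  obtain ⟨j, hj, hj0⟩ := hJ
  exact ⟨⟨e j, Submodule.subset_span ⟨j, hj, rfl⟩⟩, 0, fun h => hj0 (congrArg Subtype.val h)⟩

omit [MeasurableSpace E] [BorelSpace E] in
lemma inner_orthogonalProjectionOnto {V : Submodule ℝ E} (y : V) (κ : E) :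
    ⟪y, V.orthogonalProjectionOnto κ⟫ = ⟪(y : E), κ⟫ := by
  rw [Submodule.inner_orthogonalProjectionOnto_eq_of_mem_left]

lemma stdGaussian_rejOn_le_of_not_isRay (hh : ∀ l, 0 ≤ h l) (hα : 0 < α) (hα1 : α ≤ 1)
    (hne : (poly e h).Nonempty) (hJ : ∃ j ∈ J, e j ≠ 0) (hray : ¬ ∃ v, IsRay e J v) :
    stdGaussian E (rejOn e h α J) ≤
      ENNReal.ofReal α * stdGaussian E {u | act e h (proj e h u) = J} := by
  rcases Set.eq_empty_or_nonempty {u | act e h (proj e h u) = J} with hem | ⟨u₀, hu₀⟩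
  · have : rejOn e h α J = ∅ := Set.eq_empty_of_subset_empty fun u hu => hem ▸ hu.1
    simp [this]
  have hκ₀ : act e h (proj e h u₀) = J := hu₀
  set κ₀ := proj e h u₀
  obtain ⟨V, hV⟩ : ∃ V : Submodule ℝ E, V = Submodule.span ℝ (e '' J) := ⟨_, rfl⟩
  have hnt : Nontrivial V := by rw [hV]; exact nontrivial_span hJ
  rw [stdGaussian_eq_lintegral_submodule V (measurableSet_rejOn hne hα J),
    stdGaussian_eq_lintegral_submodule V (measurableSet_act_eq hne J),
    ← lintegral_const_mul' _ _ ENNReal.ofReal_ne_top]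
  refine lintegral_mono fun q => ?_
  by_cases hq : (V.orthogonalProjectionOnto κ₀ : E) + q ∈ poly e h ∧
      act e h (V.orthogonalProjectionOnto κ₀ + q) = J
  · simp only [Set.mem_ofPred_eq]
    rw [rejOn_submodule_slice hne hray hV hκ₀ hq, act_submodule_slice hne hV hκ₀ hq]
    refine stdGaussian_cone_tail_le ?_ ?_ ?_ ?_ ?_
    · exact measurable_subtype_coe (isClosed_normalCone J).measurableSet
    · exact fun y t ht => smul_mem_normalCone J (y : E) ht
    -- Test the normal cone with `-κ₀`, admissible because `⟪e j, -κ₀⟫ = -h j ≤ 0` on `J`.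
    · intro y hy
      rw [inner_orthogonalProjectionOnto]
      have := hy (-κ₀) fun j hj => by
        rw [inner_neg_right, mem_act.1 (hκ₀ ▸ hj : j ∈ act e h κ₀)]
        exact neg_nonpos.2 (hh j)
      rw [inner_neg_right] at this
      linarith
    · simpa using hα1
    · rw [stdGaussian_norm_sq_tail]
      refine (chiSq_Ioi_quantile_le _ (by linarith)).trans ?_
      rw [sub_sub_cancel]
  · have : {y : V | (y : E) + (q : E) ∈ rejOn e h α J} = ∅ :=
      Set.eq_empty_of_forall_notMem fun y hy =>
        hq ((act_proj_add_eq_iff hne hV hκ₀ y q).1 hy.1).2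
    simp [this]

lemma stdGaussian_rejOn_eq_of_not_isRay (hh : ∀ l, h l = 0) (hα : 0 < α) (hα1 : α ≤ 1)
    (hne : (poly e h).Nonempty) (hJ : ∃ j ∈ J, e j ≠ 0) (hray : ¬ ∃ v, IsRay e J v) :
    stdGaussian E (rejOn e h α J) =
      ENNReal.ofReal α * stdGaussian E {u | act e h (proj e h u) = J} := by
  rcases Set.eq_empty_or_nonempty {u | act e h (proj e h u) = J} with hem | ⟨u₀, hu₀⟩
  · have : rejOn e h α J = ∅ := Set.eq_empty_of_subset_empty fun u hu => hem ▸ hu.1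
    simp [this, hem]
  have hκ₀ : act e h (proj e h u₀) = J := hu₀
  set κ₀ := proj e h u₀
  obtain ⟨V, hV⟩ : ∃ V : Submodule ℝ E, V = Submodule.span ℝ (e '' J) := ⟨_, rfl⟩
  have hnt : Nontrivial V := by rw [hV]; exact nontrivial_span hJ
  -- With `h = 0` the cone is not translated, so the independence of norm and direction gives an
  -- equality.
  have hc : V.orthogonalProjectionOnto κ₀ = 0 := by
    apply Submodule.orthogonalProjectionOnto_apply_of_mem_orthogonal
    rw [hV, Submodule.mem_orthogonal]
    intro v hv
    induction hv using Submodule.span_induction with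
    | mem x hx =>
      obtain ⟨j, hj, rfl⟩ := hx
      rw [mem_act.1 (hκ₀ ▸ hj : j ∈ act e h κ₀), hh j]
    | zero => simp
    | add x y _ _ hx hy => rw [inner_add_left, hx, hy, add_zero]
    | smul a x _ hx => rw [real_inner_smul_left, hx, mul_zero]
  rw [stdGaussian_eq_lintegral_submodule V (measurableSet_rejOn hne hα J),
    stdGaussian_eq_lintegral_submodule V (measurableSet_act_eq hne J),
    ← lintegral_const_mul' _ _ ENNReal.ofReal_ne_top]
  refine lintegral_congr fun q => ?_
  by_cases hq : (V.orthogonalProjectionOnto κ₀ : E) + q ∈ poly e h ∧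
      act e h (V.orthogonalProjectionOnto κ₀ + q) = J
  · simp only [Set.mem_ofPred_eq]
    rw [rejOn_submodule_slice hne hray hV hκ₀ hq, act_submodule_slice hne hV hκ₀ hq, hc]
    simp only [sub_zero]
    rw [stdGaussian_cone_tail_eq, stdGaussian_norm_sq_tail,
      chiSq_Ioi_quantile_eq Module.finrank_pos (by linarith) (by linarith), sub_sub_cancel]
    · rfl
    · exact measurable_subtype_coe (isClosed_normalCone J).measurableSet
    · exact fun y t ht => smul_mem_normalCone J (y : E) ht
  · have h1 : {y : V | (y : E) + (q : E) ∈ rejOn e h α J} = ∅ :=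
      Set.eq_empty_of_forall_notMem fun y hy =>
        hq ((act_proj_add_eq_iff hne hV hκ₀ y q).1 hy.1).2
    have h2 : {y : V | (y : E) + (q : E) ∈ {u | act e h (proj e h u) = J}} = ∅ :=
      Set.eq_empty_of_forall_notMem fun y hy =>
        hq ((act_proj_add_eq_iff hne hV hκ₀ y q).1 hy).2
    rw [h1, h2]
    simp

omit [MeasurableSpace E] [BorelSpace E] in
-- With no nonzero active row `u` is its own projection, so the statistic is 0 and cannot exceed a
-- nonnegative critical value.
lemma rejOn_eq_empty (hne : (poly e h).Nonempty) (hJ : ∀ j ∈ J, e j = 0) :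
    rejOn e h α J = ∅ := by
  refine Set.eq_empty_of_forall_notMem fun u hu => ?_
  have h1 := proj_eq_self hne (u := u) (by rw [hu.1]; exact hJ)
  have h2 := hu.2
  rw [h1, sub_self, norm_zero] at h2
  have := crit_nonneg (e := e) (h := h) α u
  norm_num at h2
  linarith

omit [FiniteDimensional ℝ E] [MeasurableSpace E] [BorelSpace E] in
lemma act_eq_subset_label_eq (hJ : ∃ j ∈ J, e j ≠ 0) :
    {u | act e h (proj e h u) = J} ⊆ {u | label e h u = J} := by
  intro u hu
  have hu' : act e h (proj e h u) = J := hu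
  change label e h u = J
  rw [label_eq_act (by rwa [hu']), hu']

lemma stdGaussian_inner_eq_zero {w : E} (hw : w ≠ 0) : stdGaussian E {u | ⟪w, u⟫ = 0} = 0 := by
  obtain ⟨K, hK, h⟩ := exists_stdGaussian_eq_withDensity E
  rw [h]
  refine withDensity_absolutelyContinuous _ _ ?_
  have h1 : {u : E | ⟪w, u⟫ = 0} = ((ℝ ∙ w)ᗮ : Submodule ℝ E) := by
    ext u
    exact Submodule.mem_orthogonal_singleton_iff_inner_right.symm
  rw [h1]
  refine Measure.addHaar_submodule _ _ fun h2 => hw ?_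
  have h3 : w ∈ (ℝ ∙ w)ᗮ := h2 ▸ Submodule.mem_top
  exact inner_self_eq_zero.1 (Submodule.mem_orthogonal_singleton_iff_inner_right.1 h3)

omit [FiniteDimensional ℝ E] [MeasurableSpace E] [BorelSpace E] in
lemma exists_nearest (he : ∃ l, e l ≠ 0) (u : E) : ∃ i, e i ≠ 0 ∧
    ∀ j, e j ≠ 0 → (h i - ⟪e i, u⟫) / ‖e i‖ ≤ (h j - ⟪e j, u⟫) / ‖e j‖ := by
  classical
  obtain ⟨l, hl⟩ := he
  obtain ⟨i, hi, hmin⟩ := Finset.exists_min_image (Finset.univ.filter fun l => e l ≠ 0)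
    (fun j => (h j - ⟪e j, u⟫) / ‖e j‖) ⟨l, by simpa using hl⟩
  simp only [Finset.mem_filter, Finset.mem_univ, true_and] at hi hmin
  exact ⟨i, hi, hmin⟩

/-- If all constraints pass through the origin, ties between nonparallel nearest constraints have
probability zero. -/
lemma stdGaussian_label_diff_act (hh : ∀ l, h l = 0) (he : ∃ l, e l ≠ 0)
    (hray : ¬ ∃ v, IsRay e J v) :
    stdGaussian E ({u | label e h u = J} \ {u | act e h (proj e h u) = J}) = 0 := by
  have hsub : {u | label e h u = J} \ {u | act e h (proj e h u) = J} ⊆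
      ⋃ p : {p : Fin k × Fin k // ‖e p.1‖⁻¹ • e p.1 - ‖e p.2‖⁻¹ • e p.2 ≠ 0},
        {u | ⟪‖e p.1.1‖⁻¹ • e p.1.1 - ‖e p.1.2‖⁻¹ • e p.1.2, u⟫ = 0} := by
    rintro u ⟨hu1, hu2⟩
    have hlab : label e h u = J := hu1
    have hact : act e h (proj e h u) ≠ J := hu2
    have H : ∀ j ∈ act e h (proj e h u), e j = 0 := by
      by_contra hc
      push Not at hc
      exact hact (label_eq_act hc ▸ hlab)
    have hm := mem_label_of_interior H
    rw [hlab] at hm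
    obtain ⟨i, hi, hmin⟩ := exists_nearest (h := h) he u
    have hiJ : i ∈ J := (hm i).2 (Or.inr ⟨hi, hmin⟩)
    -- If every row of `J` pointed along the nearest row `i`, then `J` would be a ray. Since `h =
    -- 0`, the tie with a row in another direction puts `u` on a hyperplane through the origin.
    have hex : ∃ j ∈ J, e j ≠ ‖e j‖ • (‖e i‖⁻¹ • e i) := by
      by_contra hc
      push Not at hc
      refine hray ⟨‖e i‖⁻¹ • e i, ?_, hc, i, hiJ, hi⟩
      rw [norm_smul, norm_inv, norm_norm, inv_mul_cancel₀ (norm_ne_zero_iff.2 hi)]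
    obtain ⟨j, hj, hne⟩ := hex
    have hj0 : e j ≠ 0 := by
      intro h0
      simp [h0] at hne
    have hjn : ‖e j‖ ≠ 0 := norm_ne_zero_iff.2 hj0
    have htie : (h j - ⟪e j, u⟫) / ‖e j‖ = (h i - ⟪e i, u⟫) / ‖e i‖ := by
      refine le_antisymm ?_ (hmin j hj0)
      rcases (hm j).1 hj with h1 | h1
      · exact absurd h1.1 hj0
      · exact h1.2 i hi
    refine Set.mem_iUnion.2 ⟨⟨(j, i), ?_⟩, ?_⟩
    · intro h0
      apply hne
      rw [← sub_eq_zero.1 h0, smul_smul, mul_inv_cancel₀ hjn, one_smul]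
    · change ⟪_, u⟫ = 0
      rw [inner_sub_left, real_inner_smul_left, real_inner_smul_left]
      rw [hh i, hh j] at htie
      simp only [zero_sub, div_eq_inv_mul] at htie
      linarith
  refine measure_mono_null hsub (measure_iUnion_null fun p => stdGaussian_inner_eq_zero p.2)

omit [FiniteDimensional ℝ E] [MeasurableSpace E] [BorelSpace E] in
-- As soon as some row is nonzero a nearest nonzero constraint exists, so no cell consists of zero
-- rows only and no mass escapes the equality case.
lemma label_ne_of_zero (he : ∃ l, e l ≠ 0) (hJ : ∀ j ∈ J, e j = 0) (u : E) :
    label e h u ≠ J := by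
  intro hlab
  by_cases H : ∀ j ∈ act e h (proj e h u), e j = 0
  · have hm := mem_label_of_interior H
    rw [hlab] at hm
    obtain ⟨i, hi, hmin⟩ := exists_nearest (h := h) he u
    exact hi (hJ i ((hm i).2 (Or.inr ⟨hi, hmin⟩)))
  · push Not at H
    rw [label_eq_act H] at hlab
    obtain ⟨j, hj, hj0⟩ := H
    exact hj0 (hJ j (hlab ▸ hj))

/-- The rejection event of the refined test. -/
def rej (e : Fin k → E) (h : Fin k → ℝ) (α : ℝ) : Set E :=
  {u | crit e h α (proj e h u) < ‖u - proj e h u‖ ^ 2}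

lemma stdGaussian_rej_eq_sum (hne : (poly e h).Nonempty) (hα : 0 < α) :
    stdGaussian E (rej e h α) = ∑ J, stdGaussian E (rejOn e h α J) := by
  rw [← measure_biUnion_finset _ fun J _ => measurableSet_rejOn hne hα J]
  · congr 1
    ext u
    simp [rej, rejOn]
  · intro J _ J' _ hJJ
    refine Set.disjoint_left.2 fun u hu hu' => hJJ (hu.1.symm.trans hu'.1)

lemma sum_stdGaussian_label (hne : (poly e h).Nonempty) :
    ∑ J, stdGaussian E {u | label e h u = J} = 1 := by
  rw [← measure_biUnion_finset _ fun J _ => measurableSet_label_eq hne J]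
  · rw [← measure_univ (μ := stdGaussian E)]
    congr 1
    ext u
    simp
  · intro J _ J' _ hJJ
    refine Set.disjoint_left.2 fun u hu hu' => hJJ ?_
    exact (show label e h u = J from hu).symm.trans hu'

lemma measurableSet_rej (hne : (poly e h).Nonempty) (hα : 0 < α) :
    MeasurableSet (rej e h α) := by
  have : rej e h α = ⋃ J, rejOn e h α J := by
    ext u
    simp [rej, rejOn]
  rw [this]
  exact MeasurableSet.iUnion fun J => measurableSet_rejOn hne hα J

theorem stdGaussian_rej_le (hh : ∀ l, 0 ≤ h l) (hα : 0 < α) (hα1 : α ≤ 1) :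
    stdGaussian E (rej e h α) ≤ ENNReal.ofReal α := by
  have hne : (poly e h).Nonempty := ⟨0, fun l => by simpa using hh l⟩
  rw [stdGaussian_rej_eq_sum hne hα]
  calc ∑ J, stdGaussian E (rejOn e h α J)
      ≤ ∑ J, ENNReal.ofReal α * stdGaussian E {u | label e h u = J} := by
        refine Finset.sum_le_sum fun J _ => ?_
        by_cases hJ : ∃ j ∈ J, e j ≠ 0
        · by_cases hray : ∃ v, IsRay e J v
          · obtain ⟨v, hv⟩ := hray
            exact stdGaussian_rejOn_le_of_isRay hh hα hα1 hne hv
          · refine (stdGaussian_rejOn_le_of_not_isRay hh hα hα1 hne hJ hray).trans ?_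
            exact mul_le_mul_right (measure_mono (act_eq_subset_label_eq hJ)) _
        · push Not at hJ
          rw [rejOn_eq_empty hne hJ, measure_empty]
          exact zero_le
    _ = ENNReal.ofReal α := by
        rw [← Finset.mul_sum, sum_stdGaussian_label hne, mul_one]

theorem stdGaussian_rej_eq (hh : ∀ l, h l = 0) (he : ∃ l, e l ≠ 0) (hα : 0 < α)
    (hα1 : α ≤ 1 / 2) : stdGaussian E (rej e h α) = ENNReal.ofReal α := by
  have hne : (poly e h).Nonempty := ⟨0, fun l => by simp [hh l]⟩
  rw [stdGaussian_rej_eq_sum hne hα]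
  calc ∑ J, stdGaussian E (rejOn e h α J)
      = ∑ J, ENNReal.ofReal α * stdGaussian E {u | label e h u = J} := by
        refine Finset.sum_congr rfl fun J _ => ?_
        by_cases hJ : ∃ j ∈ J, e j ≠ 0
        · by_cases hray : ∃ v, IsRay e J v
          · obtain ⟨v, hv⟩ := hray
            exact stdGaussian_rejOn_eq_of_isRay hh hα hα1 hne hv
          · rw [stdGaussian_rejOn_eq_of_not_isRay hh hα (by linarith) hne hJ hray]
            congr 1
            rw [← measure_sdiff_add_inter (s := {u | label e h u = J})
              (measurableSet_act_eq hne J), stdGaussian_label_diff_act hh he hray, zero_add,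
              Set.inter_eq_self_of_subset_right (act_eq_subset_label_eq hJ)]
        · push Not at hJ
          rw [rejOn_eq_empty hne hJ, measure_empty]
          have : {u | label e h u = J} = ∅ :=
            Set.eq_empty_of_forall_notMem fun u => label_ne_of_zero he hJ u
          rw [this, measure_empty, mul_zero]
    _ = ENNReal.ofReal α := by
        rw [← Finset.mul_sum, sum_stdGaussian_label hne, mul_one]

end General

end Size

/-! ### Standardization of the refined test -/

section Standardize

open scoped RealInnerProductSpace

variable {k n : ℕ} {ι : Type*} [Fintype ι] [DecidableEq ι]

/-- The point `m + n^{-1/2} R v`. -/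
def unstandardize (n : ℕ) (m : ι → ℝ) (R : Matrix ι ι ℝ) (v : EuclideanSpace ℝ ι) : ι → ℝ :=
  m + (Real.sqrt n)⁻¹ • (R *ᵥ v.ofLp)

/-- The rows of the constraint matrix in standardized coordinates. -/
def stdRow (A : Matrix (Fin k) ι ℝ) (R : Matrix ι ι ℝ) (l : Fin k) : EuclideanSpace ℝ ι :=
  WithLp.toLp 2 (R *ᵥ A l)

/-- The right-hand side of the constraints in standardized coordinates. -/
def stdRhs (n : ℕ) (A : Matrix (Fin k) ι ℝ) (ρ : Fin k → ℝ) (m : ι → ℝ) (l : Fin k) : ℝ :=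
  Real.sqrt n * (ρ l - (A *ᵥ m) l)

variable {m : ι → ℝ} {R S : Matrix ι ι ℝ} {A : Matrix (Fin k) ι ℝ} {ρ : Fin k → ℝ} {α : ℝ}

omit [DecidableEq ι] in
lemma inner_toLp (x y : ι → ℝ) : ⟪(WithLp.toLp 2 x : EuclideanSpace ℝ ι), WithLp.toLp 2 y⟫ =
    x ⬝ᵥ y := by
  rw [EuclideanSpace.inner_toLp_toLp, star_trivial, dotProduct_comm]

omit [DecidableEq ι] in
lemma dotProduct_mulVec_symm (hR : Rᵀ = R) (x y : ι → ℝ) : (R *ᵥ x) ⬝ᵥ y = x ⬝ᵥ R *ᵥ y := by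
  rw [dotProduct_mulVec, ← mulVec_transpose, hR]

omit [DecidableEq ι] in
lemma inner_stdRow (hR : Rᵀ = R) (hRR : R * R = S) (i j : Fin k) :
    ⟪stdRow A R i, stdRow A R j⟫ = A i ⬝ᵥ S *ᵥ A j := by
  rw [stdRow, stdRow, inner_toLp, dotProduct_mulVec_symm hR, mulVec_mulVec, hRR]

omit [DecidableEq ι] in
lemma wnorm_eq_norm_stdRow (hR : Rᵀ = R) (hRR : R * R = S) (i : Fin k) :
    wnorm S (A i) = ‖stdRow A R i‖ := by
  rw [wnorm, ← inner_stdRow hR hRR, real_inner_self_eq_norm_sq, Real.sqrt_sq (norm_nonneg _)]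

omit [DecidableEq ι] in
lemma stdRhs_sub_inner (hn : 0 < n) (hR : Rᵀ = R) (v : EuclideanSpace ℝ ι) (l : Fin k) :
    stdRhs n A ρ m l - ⟪stdRow A R l, v⟫ =
      Real.sqrt n * (ρ l - (A *ᵥ unstandardize n m R v) l) := by
  have hs : Real.sqrt n ≠ 0 := (Real.sqrt_pos.2 (by exact_mod_cast hn)).ne'
  have h1 : ⟪stdRow A R l, v⟫ = A l ⬝ᵥ R *ᵥ v.ofLp := by
    rw [← dotProduct_mulVec_symm hR]
    exact inner_toLp _ v.ofLp
  have h2 : (A *ᵥ unstandardize n m R v) l =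
      (A *ᵥ m) l + (Real.sqrt n)⁻¹ * (A l ⬝ᵥ R *ᵥ v.ofLp) := by
    rw [unstandardize, mulVec_add, mulVec_smul]
    rfl
  rw [h1, h2, stdRhs]
  field_simp
  ring

omit [DecidableEq ι] in
lemma unstandardize_mem_feasible (hn : 0 < n) (hR : Rᵀ = R) (v : EuclideanSpace ℝ ι) :
    unstandardize n m R v ∈ feasible A ρ ↔ v ∈ poly (stdRow A R) (stdRhs n A ρ m) := by
  have hs : 0 < Real.sqrt n := Real.sqrt_pos.2 (by exact_mod_cast hn)
  refine forall_congr' fun l => ?_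
  rw [← sub_nonneg, ← sub_nonneg (b := ⟪_, _⟫), stdRhs_sub_inner hn hR, mul_nonneg_iff_of_pos_left hs]

lemma objective_unstandardize (hn : 0 < n) (hR : Rᵀ = R) (hRR : R * R = S) (hdet : IsUnit R.det)
    (u v : EuclideanSpace ℝ ι) :
    objective n S (unstandardize n m R u) (unstandardize n m R v) = ‖u - v‖ ^ 2 := by
  have hn' : (0 : ℝ) < n := by exact_mod_cast hn
  have h1 : unstandardize n m R u - unstandardize n m R v =
      (Real.sqrt n)⁻¹ • (R *ᵥ (u - v).ofLp) := by
    rw [unstandardize, unstandardize, WithLp.ofLp_sub, mulVec_sub, smul_sub]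
    abel
  have h2 : S⁻¹ *ᵥ (R *ᵥ (u - v).ofLp) = R⁻¹ *ᵥ (u - v).ofLp := by
    rw [← hRR, Matrix.mul_inv_rev, mulVec_mulVec, Matrix.mul_assoc, Matrix.nonsing_inv_mul _ hdet,
      Matrix.mul_one]
  have h3 : (R *ᵥ (u - v).ofLp) ⬝ᵥ (R⁻¹ *ᵥ (u - v).ofLp) = ‖u - v‖ ^ 2 := by
    rw [dotProduct_mulVec_symm hR, mulVec_mulVec, Matrix.mul_nonsing_inv _ hdet, one_mulVec,
      ← inner_toLp, ← real_inner_self_eq_norm_sq]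
  rw [objective, h1, mulVec_smul, h2, smul_dotProduct, dotProduct_smul, h3, smul_eq_mul, smul_eq_mul,
    ← mul_assoc, ← mul_assoc, mul_assoc (n : ℝ), ← mul_inv, Real.mul_self_sqrt hn'.le,
    mul_inv_cancel₀ hn'.ne', one_mul]

lemma unstandardize_surjective (hn : 0 < n) (hdet : IsUnit R.det) :
    Function.Surjective (unstandardize n m R) := by
  have hs : Real.sqrt n ≠ 0 := (Real.sqrt_pos.2 (by exact_mod_cast hn)).ne'
  intro x
  refine ⟨WithLp.toLp 2 (R⁻¹ *ᵥ (Real.sqrt n • (x - m))), ?_⟩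
  rw [unstandardize, mulVec_mulVec, Matrix.mul_nonsing_inv _ hdet, one_mulVec, smul_smul,
    inv_mul_cancel₀ hs, one_smul]
  abel

lemma proj_eq_iff_isMinOn {E : Type*} [NormedAddCommGroup E] [InnerProductSpace ℝ E]
    [FiniteDimensional ℝ E] {e : Fin k → E} {h : Fin k → ℝ} (hne : (poly e h).Nonempty) {u p : E}
    (hp : p ∈ poly e h) :
    proj e h u = p ↔ ∀ w ∈ poly e h, ‖u - p‖ ^ 2 ≤ ‖u - w‖ ^ 2 := by
  have hpr := proj_spec hne u
  constructor
  · rintro rfl w hw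
    have h1 := hpr.2 w hw
    have h2 : u - w = (u - proj e h u) - (w - proj e h u) := by abel
    rw [h2, norm_sub_sq_real (u - proj e h u)]
    nlinarith [sq_nonneg ‖w - proj e h u‖]
  · intro H
    have h1 := H _ hpr.1
    have h3 := hpr.2 p hp
    have h2 : u - p = (u - proj e h u) - (p - proj e h u) := by abel
    rw [h2, norm_sub_sq_real (u - proj e h u)] at h1
    have h4 : ‖p - proj e h u‖ ^ 2 ≤ 0 := by linarith
    have h5 : ‖p - proj e h u‖ = 0 := by
      have := sq_nonneg ‖p - proj e h u‖
      exact pow_eq_zero_iff two_ne_zero |>.1 (le_antisymm h4 this)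
    exact (sub_eq_zero.1 (norm_eq_zero.1 h5)).symm

section

variable (hn : 0 < n) (hR : Rᵀ = R) (hRR : R * R = S) (hdet : IsUnit R.det)
  (hne : (poly (stdRow A R) (stdRhs n A ρ m)).Nonempty) (u : EuclideanSpace ℝ ι)
include hn hR hRR hdet hne

lemma isMinOn_unstandardize_iff {v : EuclideanSpace ℝ ι}
    (hv : v ∈ poly (stdRow A R) (stdRhs n A ρ m)) :
    IsMinOn (objective n S (unstandardize n m R u)) (feasible A ρ) (unstandardize n m R v) ↔
      proj (stdRow A R) (stdRhs n A ρ m) u = v := by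
  rw [proj_eq_iff_isMinOn hne hv, isMinOn_iff]
  constructor
  · intro H w hw
    rw [← objective_unstandardize (m := m) hn hR hRR hdet,
      ← objective_unstandardize (m := m) hn hR hRR hdet]
    exact H _ ((unstandardize_mem_feasible hn hR w).2 hw)
  · intro H x hx
    obtain ⟨w, rfl⟩ := unstandardize_surjective (m := m) hn hdet x
    rw [objective_unstandardize hn hR hRR hdet, objective_unstandardize hn hR hRR hdet]
    exact H w ((unstandardize_mem_feasible hn hR w).1 hx)

lemma kappaHat_unstandardize : kappaHat n A ρ S (unstandardize n m R u) =
    unstandardize n m R (proj (stdRow A R) (stdRhs n A ρ m) u) := by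
  have hp := (proj_spec hne u).1
  have hex : ∃ κ ∈ feasible A ρ,
      IsMinOn (objective n S (unstandardize n m R u)) (feasible A ρ) κ :=
    ⟨_, (unstandardize_mem_feasible hn hR _).2 hp,
      (isMinOn_unstandardize_iff hn hR hRR hdet hne u hp).2 rfl⟩
  rw [kappaHat, dif_pos hex]
  obtain ⟨h1, h2⟩ := hex.choose_spec
  obtain ⟨w, hw⟩ := unstandardize_surjective (m := m) hn hdet hex.choose
  rw [← hw] at h1 h2 ⊢
  rw [unstandardize_mem_feasible hn hR] at h1
  rw [(isMinOn_unstandardize_iff hn hR hRR hdet hne u h1).1 h2]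

lemma testStat_unstandardize : testStat n A ρ S (unstandardize n m R u) =
    ‖u - proj (stdRow A R) (stdRhs n A ρ m) u‖ ^ 2 := by
  have hp := (proj_spec hne u).1
  rw [← objective_unstandardize (m := m) hn hR hRR hdet]
  refine IsLeast.csInf_eq ⟨⟨_, (unstandardize_mem_feasible hn hR _).2 hp, rfl⟩, ?_⟩
  rintro _ ⟨x, hx, rfl⟩
  exact (isMinOn_unstandardize_iff hn hR hRR hdet hne u hp).2 rfl hx

lemma slack_unstandardize (l : Fin k) :
    Real.sqrt n * (ρ l - (A *ᵥ kappaHat n A ρ S (unstandardize n m R u)) l) =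
      stdRhs n A ρ m l - ⟪stdRow A R l, proj (stdRow A R) (stdRhs n A ρ m) u⟫ := by
  rw [stdRhs_sub_inner hn hR, kappaHat_unstandardize hn hR hRR hdet hne]

lemma activeSet_unstandardize : activeSet n A ρ S (unstandardize n m R u) =
    act (stdRow A R) (stdRhs n A ρ m) (proj (stdRow A R) (stdRhs n A ρ m) u) := by
  have hs : Real.sqrt n ≠ 0 := (Real.sqrt_pos.2 (by exact_mod_cast hn)).ne'
  ext l
  have := slack_unstandardize hn hR hRR hdet hne u l
  rw [mem_act, activeSet, Finset.mem_filter, eq_comm, ← sub_eq_zero, eq_comm (b := stdRhs n A ρ m l),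
    ← sub_eq_zero (a := stdRhs n A ρ m l), ← this]
  simp [hs]

/-- Dividing numerator and denominator of `zj` by `‖stdRow A R i‖` gives the terms of `zCrit`; the
additional term `j = i` there is `⊤`. -/
lemma zInf_unstandardize {i : Fin k} (hi : stdRow A R i ≠ 0) :
    zInf n A ρ S (unstandardize n m R u) i =
      zCrit (stdRow A R) (stdRhs n A ρ m) (proj (stdRow A R) (stdRhs n A ρ m) u)
        (‖stdRow A R i‖⁻¹ • stdRow A R i) := by
  have hi0 : ‖stdRow A R i‖ ≠ 0 := norm_ne_zero_iff.2 hi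
  have hin : ∀ j, ⟪stdRow A R j, ‖stdRow A R i‖⁻¹ • stdRow A R i⟫ =
      ‖stdRow A R i‖⁻¹ * (A i ⬝ᵥ S *ᵥ A j) := fun j => by
    rw [real_inner_smul_right, real_inner_comm, inner_stdRow hR hRR]
  have hz : ∀ j, zj n A ρ S (unstandardize n m R u) i j =
      if ⟪stdRow A R j, ‖stdRow A R i‖⁻¹ • stdRow A R i⟫ = ‖stdRow A R j‖ then (⊤ : EReal) else
      (((stdRhs n A ρ m j - ⟪stdRow A R j, proj (stdRow A R) (stdRhs n A ρ m) u⟫) /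
        (‖stdRow A R j‖ - ⟪stdRow A R j, ‖stdRow A R i‖⁻¹ • stdRow A R i⟫) : ℝ) : EReal) := by
    intro j
    rw [zj, wnorm_eq_norm_stdRow hR hRR, wnorm_eq_norm_stdRow hR hRR, hin,
      ← slack_unstandardize hn hR hRR hdet hne]
    have hiff : ‖stdRow A R i‖⁻¹ * (A i ⬝ᵥ S *ᵥ A j) = ‖stdRow A R j‖ ↔
        ‖stdRow A R i‖ * ‖stdRow A R j‖ = A i ⬝ᵥ S *ᵥ A j := by
      rw [inv_mul_eq_iff_eq_mul₀ hi0, eq_comm]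
    by_cases hc : ‖stdRow A R i‖ * ‖stdRow A R j‖ = A i ⬝ᵥ S *ᵥ A j
    · rw [if_neg (not_not.2 hc), if_pos (hiff.2 hc)]
    · rw [if_pos hc, if_neg (mt hiff.1 hc)]
      congr 1
      have e1 : ‖stdRow A R j‖ - ‖stdRow A R i‖⁻¹ * (A i ⬝ᵥ S *ᵥ A j) =
          (‖stdRow A R i‖ * ‖stdRow A R j‖ - A i ⬝ᵥ S *ᵥ A j) / ‖stdRow A R i‖ := by
        field_simp
      rw [e1, div_div_eq_mul_div]
      congr 1
      ring
  rw [zInf, zCrit]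
  refine le_antisymm (le_iInf fun j => ?_) (le_iInf fun j => ?_)
  · by_cases hj : j = i
    · rw [if_pos]
      · exact le_top
      · rw [hj, real_inner_smul_right, real_inner_self_eq_norm_sq]
        field_simp
    · have := iInf_le (fun j : {j // j ≠ i} => zj n A ρ S (unstandardize n m R u) i j) ⟨j, hj⟩
      refine this.trans (le_of_eq ?_)
      exact (hz j).trans (by congr)
  · rw [hz]
    refine (iInf_le _ (j : Fin k)).trans (le_of_eq (by congr))

end

lemma stdRow_eq_zero_iff (hdet : IsUnit R.det) (l : Fin k) : stdRow A R l = 0 ↔ A l = 0 := by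
  rw [stdRow]
  constructor
  · intro h
    have h1 : R *ᵥ A l = 0 := congrArg WithLp.ofLp h
    have h2 : R⁻¹ *ᵥ (R *ᵥ A l) = A l := by
      rw [mulVec_mulVec, Matrix.nonsing_inv_mul _ hdet, one_mulVec]
    rw [← h2, h1, mulVec_zero]
  · intro h
    rw [h, mulVec_zero]
    rfl

lemma rowRank_eq_finrank (hdet : IsUnit R.det) (J : Finset (Fin k)) :
    rowRank A J = Module.finrank ℝ (Submodule.span ℝ (stdRow A R '' J)) := by
  let L : (ι → ℝ) →ₗ[ℝ] EuclideanSpace ℝ ι :=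
    (WithLp.linearEquiv 2 ℝ (ι → ℝ)).symm.toLinearMap ∘ₗ R.mulVecLin
  have hL : Function.Injective L := by
    refine (WithLp.linearEquiv 2 ℝ (ι → ℝ)).symm.injective.comp ?_
    exact Matrix.mulVec_injective_of_isUnit ((Matrix.isUnit_iff_isUnit_det R).2 hdet)
  have h1 : stdRow A R '' J = L '' (Set.range (A.submatrix (fun l : J => (l : Fin k)) id).row) := by
    ext x
    constructor
    · rintro ⟨l, hl, rfl⟩
      exact ⟨_, ⟨⟨l, hl⟩, rfl⟩, rfl⟩
    · rintro ⟨_, ⟨l, rfl⟩, rfl⟩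
      exact ⟨l, l.2, rfl⟩
  rw [h1, Submodule.span_image, ← (Submodule.equivMapOfInjective L hL _).finrank_eq, rowRank,
    Matrix.rank_eq_finrank_span_row]

/-- The test branches on rank 1, `crit` on a common direction. They differ only when the active rows
span a line but contain opposite vectors; then `z = 0`, and `2αΦ(0) = α` is the unrefined level. -/
lemma rccTest_unstandardize (hn : 0 < n) (hR : Rᵀ = R) (hRR : R * R = S) (hdet : IsUnit R.det)
    (hne : (poly (stdRow A R) (stdRhs n A ρ m)).Nonempty) (u : EuclideanSpace ℝ ι) :
    rccTest n A ρ S α (unstandardize n m R u) =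
      (rej (stdRow A R) (stdRhs n A ρ m) α).indicator 1 u := by
  classical
  set e := stdRow A R with he
  set h := stdRhs n A ρ m with hh
  set κ := proj e h u with hκ
  set J := act e h κ with hJ
  have hact : activeSet n A ρ S (unstandardize n m R u) = J :=
    activeSet_unstandardize hn hR hRR hdet hne u
  have hr : rHat n A ρ S (unstandardize n m R u) =
      Module.finrank ℝ (Submodule.span ℝ (e '' J)) := by
    rw [rHat, hact, rowRank_eq_finrank hdet]
  have hT := testStat_unstandardize hn hR hRR hdet hne u
  have hz := fun i => zInf_unstandardize hn hR hRR hdet hne u (i := i)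
  have hz0 := stdRow_eq_zero_iff (A := A) hdet
  have hκp : κ ∈ poly e h := (proj_spec hne u).1
  have hcrit : chiSqQuantile (rHat n A ρ S (unstandardize n m R u))
      (1 - betaHat n A ρ S α (unstandardize n m R u)) = crit e h α κ := by
    by_cases hray : ∃ v, IsRay e J v
    · obtain ⟨v, hv⟩ := hray
      have hspan : Module.finrank ℝ (Submodule.span ℝ (e '' J)) = 1 := by
        obtain ⟨j, hj, hj0⟩ := hv.exists_ne_zero
        have : Submodule.span ℝ (e '' J) = ℝ ∙ e j := by
          refine le_antisymm (Submodule.span_le.2 ?_) ?_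
          · rintro _ ⟨l, hl, rfl⟩
            refine Submodule.mem_span_singleton.2 ⟨‖e l‖ * ‖e j‖⁻¹, ?_⟩
            have hvj : ‖e j‖⁻¹ • e j = v := by
              rw [inv_smul_eq_iff₀ (norm_ne_zero_iff.2 hj0)]
              exact hv.eq_smul j hj
            rw [mul_smul, hvj]
            exact (hv.eq_smul l hl).symm
          · exact Submodule.span_mono (by simpa using ⟨j, hj, rfl⟩)
        rw [this, finrank_span_singleton hj0]
      have hex : ∃ i, i ∈ activeSet n A ρ S (unstandardize n m R u) ∧ A i ≠ 0 := by
        obtain ⟨j, hj, hj0⟩ := hv.exists_ne_zero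
        exact ⟨j, by rwa [hact], fun h0 => hj0 ((hz0 j).2 h0)⟩
      have hi := hex.choose_spec
      rw [crit_eq_of_isRay hv, hr, betaHat, hr, if_pos hspan, dif_pos hex]
      set i := hex.choose
      have hi0 : e i ≠ 0 := fun h0 => hi.2 ((hz0 i).1 h0)
      have hvi : ‖e i‖⁻¹ • e i = v := by
        rw [inv_smul_eq_iff₀ (norm_ne_zero_iff.2 hi0)]
        exact hv.eq_smul i (hact ▸ hi.1)
      rw [hz i hi0, hvi, hspan]
    · rw [crit_eq_of_not_isRay hray, hr]
      congr 2
      rw [betaHat, hr]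
      split_ifs with h1 hex
      · have hi := hex.choose_spec
        set i := hex.choose
        have hi0 : e i ≠ 0 := fun h0 => hi.2 ((hz0 i).1 h0)
        have hiJ : i ∈ J := hact ▸ hi.1
        have hin : ‖e i‖ ≠ 0 := norm_ne_zero_iff.2 hi0
        have hunit : ‖‖e i‖⁻¹ • e i‖ = 1 := by
          rw [norm_smul, norm_inv, norm_norm, inv_mul_cancel₀ hin]
        have hbad : ∃ j ∈ J, e j ≠ ‖e j‖ • (‖e i‖⁻¹ • e i) := by
          by_contra hc
          push Not at hc
          exact hray ⟨_, hunit, hc, i, hiJ, hi0⟩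
        obtain ⟨j, hj, hjne⟩ := hbad
        have hspan : Submodule.span ℝ (e '' J) = ℝ ∙ e i := by
          refine (Submodule.eq_of_le_of_finrank_eq
            (Submodule.span_mono (by simpa using ⟨i, hiJ, rfl⟩)) ?_).symm
          rw [h1, finrank_span_singleton hi0]
        have hjs : e j ∈ ℝ ∙ e i := hspan ▸ Submodule.subset_span ⟨j, hj, rfl⟩
        obtain ⟨c, hc⟩ := Submodule.mem_span_singleton.1 hjs
        have hcneg : c < 0 := by
          by_contra hc0
          push Not at hc0
          apply hjne
          rw [← hc, norm_smul, Real.norm_of_nonneg hc0, smul_smul, mul_assoc,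
            mul_inv_cancel₀ hin, mul_one]
        -- The opposite active row `j` has zero slack and a nonzero denominator, so its term is 0.
        have hzz : zCrit e h κ (‖e i‖⁻¹ • e i) = 0 := by
          refine le_antisymm ((iInf_le _ j).trans ?_) (zCrit_nonneg hunit hκp)
          have h3 : ⟪e j, ‖e i‖⁻¹ • e i⟫ = c * ‖e i‖ := by
            rw [← hc, real_inner_smul_left, real_inner_smul_right, real_inner_self_eq_norm_sq]
            field_simp
          have h4 : ⟪e j, ‖e i‖⁻¹ • e i⟫ ≠ ‖e j‖ := by
            rw [h3]
            have h5 : 0 < ‖e i‖ := norm_pos_iff.2 hi0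
            have h6 : c * ‖e i‖ < 0 := mul_neg_of_neg_of_pos hcneg h5
            exact (h6.trans_le (norm_nonneg _)).ne
          rw [if_neg h4, mem_act.1 hj, sub_self, zero_div]
          simp
        rw [hz i hi0, hzz, stdNormalCDF_zero]
        ring
      · rfl
      · rfl
  rw [rccTest, hcrit, hT]
  by_cases hu : u ∈ rej e h α
  · rw [Set.indicator_of_mem hu]
    exact if_pos hu
  · rw [Set.indicator_of_notMem hu]
    exact if_neg hu

end Standardize

/-! ### The size of the test for a normal sample moment -/

section SquareRoot

open scoped MatrixOrder

variable {ι : Type*} [Fintype ι] [DecidableEq ι] {S : Matrix ι ι ℝ}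

lemma sqrt_posDef (hS : S.PosDef) : (CFC.sqrt S)ᵀ = CFC.sqrt S ∧ CFC.sqrt S * CFC.sqrt S = S ∧
    IsUnit (CFC.sqrt S).det := by
  have h1 : CFC.sqrt S * CFC.sqrt S = S := CFC.sqrt_mul_sqrt_self S hS.posSemidef.nonneg
  refine ⟨?_, h1, ?_⟩
  · have := (CFC.sqrt_nonneg S).isSelfAdjoint.star_eq
    rwa [star_eq_conjTranspose, conjTranspose_eq_transpose_of_trivial] at this
  · have h2 : (CFC.sqrt S).det * (CFC.sqrt S).det = S.det := by rw [← det_mul, h1]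
    refine isUnit_iff_ne_zero.2 fun h0 => ?_
    rw [h0, mul_zero] at h2
    exact hS.det_pos.ne h2

end SquareRoot

/-! ### Joint measurability in the variance matrix and the sample moment -/

section Measurability

open scoped MatrixOrder

variable {k n : ℕ} {ι : Type*} [Fintype ι] [DecidableEq ι]

lemma measurableSet_posDef : MeasurableSet {S : ι → ι → ℝ | (Matrix.of S).PosDef} := by
  have hc : Continuous fun S : ι → ι → ℝ => (Matrix.of S : Matrix ι ι ℝ) := continuous_id
  have h1 : IsClosed {S : ι → ι → ℝ | (Matrix.of S).PosSemidef} := by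
    have : {S : ι → ι → ℝ | (Matrix.of S).PosSemidef} = {S | (Matrix.of S)ᵀ = Matrix.of S} ∩
        ⋂ x : ι → ℝ, {S | 0 ≤ x ⬝ᵥ (Matrix.of S) *ᵥ x} := by
      ext S
      simp [Matrix.posSemidef_iff_dotProduct_mulVec, Matrix.IsHermitian,
        conjTranspose_eq_transpose_of_trivial]
    rw [this]
    refine (isClosed_eq hc.matrix_transpose hc).inter (isClosed_iInter fun x => ?_)
    exact isClosed_le continuous_const
      (continuous_const.dotProduct (hc.matrix_mulVec continuous_const))
  have h2 : {S : ι → ι → ℝ | (Matrix.of S).PosDef} = {S | (Matrix.of S).PosSemidef} ∩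
      {S | (Matrix.of S).det ≠ 0} := by
    ext S
    exact ⟨fun h => ⟨h.posSemidef, h.det_pos.ne'⟩, fun h => h.1.posDef_iff_det_ne_zero.2 h.2⟩
  rw [h2]
  exact h1.measurableSet.inter (isOpen_ne_fun hc.matrix_det continuous_const).measurableSet

lemma measurable_objective : Measurable fun p : (ι → ι → ℝ) × (ι → ℝ) × (ι → ℝ) =>
    objective n (Matrix.of p.1) p.2.1 p.2.2 := by
  have hc : Continuous fun S : ι → ι → ℝ => (Matrix.of S : Matrix ι ι ℝ) := continuous_id
  have hinv : ∀ i j, Measurable fun S : ι → ι → ℝ => (Matrix.of S)⁻¹ i j := by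
    intro i j
    have : (fun S : ι → ι → ℝ => (Matrix.of S)⁻¹ i j) =
        fun S => (Matrix.of S).det⁻¹ * (Matrix.of S).adjugate i j := by
      ext S
      rw [Matrix.inv_def, Ring.inverse_eq_inv', Matrix.smul_apply, smul_eq_mul]
    rw [this]
    exact hc.matrix_det.measurable.inv.mul (hc.matrix_adjugate.matrix_elem i j).measurable
  simp only [objective, dotProduct, mulVec]
  refine measurable_const.mul (Finset.measurable_sum _ fun i _ => Measurable.mul (by fun_prop)
    (Finset.measurable_sum _ fun j _ => Measurable.mul ?_ (by fun_prop)))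
  exact (hinv i j).comp measurable_fst

lemma continuous_objective (S : Matrix ι ι ℝ) (x : ι → ℝ) : Continuous (objective n S x) := by
  unfold objective
  fun_prop

/-- The pairs of a positive definite variance matrix and a sample moment. -/
abbrev PosDefPair (ι : Type*) [Fintype ι] : Type _ :=
  {p : (ι → ι → ℝ) × (ι → ℝ) // (Matrix.of p.1 : Matrix ι ι ℝ).PosDef}

variable {A : Matrix (Fin k) ι ℝ} {ρ : Fin k → ℝ}

lemma kappaHat_spec (hn : 0 < n) (hne : (feasible A ρ).Nonempty) {S : Matrix ι ι ℝ}
    (hS : S.PosDef) (x : ι → ℝ) (κ : ι → ℝ) :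
    κ = kappaHat n A ρ S x ↔ κ ∈ feasible A ρ ∧ IsMinOn (objective n S x) (feasible A ρ) κ := by
  obtain ⟨hR, hRR, hdet⟩ := sqrt_posDef hS
  set R := CFC.sqrt S
  have hsurj := unstandardize_surjective (m := 0) (R := R) hn hdet
  obtain ⟨u, rfl⟩ := hsurj x
  have hne' : (poly (stdRow A R) (stdRhs n A ρ 0)).Nonempty := by
    obtain ⟨κ, hκ⟩ := hne
    obtain ⟨v, rfl⟩ := hsurj κ
    exact ⟨v, (unstandardize_mem_feasible hn hR v).1 hκ⟩
  rw [kappaHat_unstandardize hn hR hRR hdet hne']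
  have hp := (proj_spec hne' u).1
  constructor
  · rintro rfl
    exact ⟨(unstandardize_mem_feasible hn hR _).2 hp,
      (isMinOn_unstandardize_iff hn hR hRR hdet hne' u hp).2 rfl⟩
  · rintro ⟨h1, h2⟩
    obtain ⟨v, rfl⟩ := hsurj κ
    rw [unstandardize_mem_feasible hn hR] at h1
    rw [(isMinOn_unstandardize_iff hn hR hRR hdet hne' u h1).1 h2]

/-- By the Lusin-Souslin theorem: the triples (variance, moment, minimizer) with minimizer in `U`
form a Borel set, and by uniqueness of the minimizer the projection forgetting it is injective
there, so the image is Borel. -/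
lemma measurable_kappaHat (hn : 0 < n) (hne : (feasible A ρ).Nonempty) :
    Measurable fun p : PosDefPair ι => kappaHat n A ρ (Matrix.of p.1.1) p.1.2 := by
  have hclosed : IsClosed (feasible A ρ) := by
    have : feasible A ρ = ⋂ l, {κ | (A *ᵥ κ) l ≤ ρ l} := by
      ext κ
      simp [feasible]
    rw [this]
    exact isClosed_iInter fun l => isClosed_le
      ((continuous_apply l).comp (continuous_const.matrix_mulVec continuous_id)) continuous_const
  have : Nonempty (feasible A ρ) := hne.to_subtype
  let D : ℕ → feasible A ρ := TopologicalSpace.denseSeq (feasible A ρ)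
  have hD : DenseRange D := TopologicalSpace.denseRange_denseSeq _
  -- By continuity, minimality need only be tested on a countable dense subset of the polyhedron,
  -- which makes the graph Borel.
  have hmin : ∀ (S : Matrix ι ι ℝ) (x κ : ι → ℝ), IsMinOn (objective n S x) (feasible A ρ) κ ↔
      ∀ i, objective n S x κ ≤ objective n S x (D i) := by
    intro S x κ
    rw [isMinOn_iff]
    refine ⟨fun H i => H _ (D i).2, fun H w hw => ?_⟩
    have hcl : IsClosed {w : feasible A ρ | objective n S x κ ≤ objective n S x w} :=
      isClosed_le continuous_const ((continuous_objective S x).comp continuous_subtype_val)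
    have : (⟨w, hw⟩ : feasible A ρ) ∈ {w : feasible A ρ | objective n S x κ ≤ objective n S x w} :=
      hcl.closure_subset_iff.2 (Set.range_subset_iff.2 H) (hD ⟨w, hw⟩)
    exact this
  intro U hU
  let Γ : Set ((ι → ι → ℝ) × (ι → ℝ) × (ι → ℝ)) :=
    {p | (Matrix.of p.1).PosDef ∧ (p.2.2 ∈ feasible A ρ ∧
      ∀ i, objective n (Matrix.of p.1) p.2.1 p.2.2 ≤ objective n (Matrix.of p.1) p.2.1 (D i)) ∧
      p.2.2 ∈ U}
  have hobj := measurable_objective (n := n) (ι := ι)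
  have hΓ : MeasurableSet Γ := by
    refine (measurable_fst measurableSet_posDef).inter (MeasurableSet.inter (MeasurableSet.inter
      ((measurable_snd.comp measurable_snd) hclosed.measurableSet) ?_)
        ((measurable_snd.comp measurable_snd) hU))
    have : {p : (ι → ι → ℝ) × (ι → ℝ) × (ι → ℝ) | ∀ i, objective n (Matrix.of p.1) p.2.1 p.2.2 ≤
        objective n (Matrix.of p.1) p.2.1 (D i)} = ⋂ i, {p |
        objective n (Matrix.of p.1) p.2.1 p.2.2 ≤ objective n (Matrix.of p.1) p.2.1 (D i)} := by
      ext p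
      simp
    have hm : MeasurableSet {p : (ι → ι → ℝ) × (ι → ℝ) × (ι → ℝ) | ∀ i,
        objective n (Matrix.of p.1) p.2.1 p.2.2 ≤ objective n (Matrix.of p.1) p.2.1 (D i)} := by
      rw [this]
      refine MeasurableSet.iInter fun i => measurableSet_le hobj ?_
      exact hobj.comp (by fun_prop : Measurable fun p : (ι → ι → ℝ) × (ι → ℝ) × (ι → ℝ) =>
        (p.1, p.2.1, (D i : ι → ℝ)))
    exact hm
  have hf : Measurable fun p : (ι → ι → ℝ) × (ι → ℝ) × (ι → ℝ) => (p.1, p.2.1) := by fun_prop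
  have hinj : Set.InjOn (fun p : (ι → ι → ℝ) × (ι → ℝ) × (ι → ℝ) => (p.1, p.2.1)) Γ := by
    rintro ⟨S, x, κ⟩ ⟨h1, h2, -⟩ ⟨S', x', κ'⟩ ⟨h1', h2', -⟩ heq
    obtain ⟨rfl, rfl⟩ := Prod.mk.inj heq
    rw [← hmin] at h2 h2'
    rw [(kappaHat_spec hn hne h1 x κ).2 h2, (kappaHat_spec hn hne h1 x κ').2 h2']
  have : StandardBorelSpace (ι → ι → ℝ) := StandardBorelSpace.pi_countable
  have himg := hΓ.image_of_measurable_injOn hf hinj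
  convert measurable_subtype_coe himg using 1
  ext ⟨⟨S, x⟩, hS⟩
  simp only [Set.mem_preimage, Set.mem_image, Prod.exists, Prod.mk.injEq]
  constructor
  · intro hκ
    have := (kappaHat_spec hn hne hS x _).1 rfl
    rw [hmin] at this
    exact ⟨S, x, _, ⟨hS, this, hκ⟩, rfl, rfl⟩
  · rintro ⟨S', x', κ, ⟨h1, h2, h3⟩, rfl, rfl⟩
    rw [← hmin] at h2
    rwa [← (kappaHat_spec hn hne hS x' κ).2 h2]

/-- Cauchy-Schwarz for the form defined by `S` makes the denominators nonnegative. Hence `Φ(z) ≥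
1/2`, which keeps the random quantile level below 1. -/
lemma zInf_nonneg (hn : 0 < n) (hne : (feasible A ρ).Nonempty) {S : Matrix ι ι ℝ}
    (hS : S.PosDef) (x : ι → ℝ) (i : Fin k) : 0 ≤ zInf n A ρ S x i := by
  obtain ⟨hR, hRR, hdet⟩ := sqrt_posDef hS
  refine le_iInf fun j => ?_
  rw [zj]
  split_ifs with hj
  · have h1 := ((kappaHat_spec hn hne hS x _).1 rfl).1 j
    have h2 := real_inner_le_norm (stdRow A (CFC.sqrt S) i) (stdRow A (CFC.sqrt S) j)
    rw [inner_stdRow hR hRR, ← wnorm_eq_norm_stdRow hR hRR, ← wnorm_eq_norm_stdRow hR hRR] at h2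
    have h3 : 0 ≤ wnorm S (A i) := Real.sqrt_nonneg _
    exact_mod_cast div_nonneg (mul_nonneg (mul_nonneg (Real.sqrt_nonneg _) h3) (sub_nonneg.2 h1))
      (sub_nonneg.2 h2)
  · exact le_top

lemma measurable_zInf (hn : 0 < n) (hne : (feasible A ρ).Nonempty) (i : Fin k) :
    Measurable fun p : PosDefPair ι => zInf n A ρ (Matrix.of p.1.1) p.1.2 i := by
  have hκ := measurable_kappaHat hn hne
  have hS : ∀ a b : ι → ℝ, Measurable fun p : PosDefPair ι => a ⬝ᵥ (Matrix.of p.1.1) *ᵥ b := by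
    intro a b
    simp only [dotProduct, mulVec, Matrix.of_apply]
    fun_prop
  have hw : ∀ a : ι → ℝ, Measurable fun p : PosDefPair ι => wnorm (Matrix.of p.1.1) a :=
    fun a => (hS a a).sqrt
  have hA : ∀ l, Measurable fun p : PosDefPair ι =>
      (A *ᵥ kappaHat n A ρ (Matrix.of p.1.1) p.1.2) l := by
    intro l
    simp only [dotProduct, mulVec]
    fun_prop
  refine Measurable.iInf fun j => ?_
  unfold zj
  refine Measurable.ite ?_ (measurable_coe_real_ereal.comp ?_) measurable_const
  · exact (measurableSet_eq_fun ((hw _).mul (hw _)) (hS _ _)).compl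
  · exact ((measurable_const.mul (hw _)).mul (measurable_const.sub (hA j))).div
      (((hw _).mul (hw _)).sub (hS _ _))

lemma testStat_eq_objective (hn : 0 < n) (hne : (feasible A ρ).Nonempty) {S : Matrix ι ι ℝ}
    (hS : S.PosDef) (x : ι → ℝ) :
    testStat n A ρ S x = objective n S x (kappaHat n A ρ S x) := by
  obtain ⟨h1, h2⟩ := (kappaHat_spec hn hne hS x _).1 rfl
  refine IsLeast.csInf_eq ⟨⟨_, h1, rfl⟩, ?_⟩
  rintro _ ⟨w, hw, rfl⟩
  exact h2 hw

open Classical in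
/-- The refined test is jointly measurable in the variance matrix and the sample moment. -/
lemma measurable_rccTest (hn : 0 < n) {α : ℝ} (hα : 0 < α) :
    Measurable fun p : PosDefPair ι => rccTest n A ρ (Matrix.of p.1.1) α p.1.2 := by
  -- Over an empty polyhedron the statistic is `sInf ∅ = 0`, so the test never rejects.
  rcases (feasible A ρ).eq_empty_or_nonempty with hem | hne
  · have : (fun p : PosDefPair ι => rccTest n A ρ (Matrix.of p.1.1) α p.1.2) = fun _ => 0 := by
      ext p
      rw [rccTest, if_neg]
      rw [testStat, hem, Set.image_empty, Real.sInf_empty, not_lt]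
      exact chiSqQuantile_nonneg _ _
    rw [this]
    exact measurable_const
  have hκ := measurable_kappaHat hn hne
  have hT : Measurable fun p : PosDefPair ι => testStat n A ρ (Matrix.of p.1.1) p.1.2 := by
    have : (fun p : PosDefPair ι => testStat n A ρ (Matrix.of p.1.1) p.1.2) = fun p =>
        objective n (Matrix.of p.1.1) p.1.2 (kappaHat n A ρ (Matrix.of p.1.1) p.1.2) := by
      ext p
      exact testStat_eq_objective hn hne p.2 _
    rw [this]
    exact measurable_objective.comp
      (f := fun p : PosDefPair ι => (p.1.1, p.1.2, kappaHat n A ρ (Matrix.of p.1.1) p.1.2))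
      (by fun_prop)
  have hact : ∀ J, MeasurableSet {p : PosDefPair ι |
      activeSet n A ρ (Matrix.of p.1.1) p.1.2 = J} := by
    refine measurableSet_finset_eq fun l => ?_
    simp only [activeSet, Finset.mem_filter, Finset.mem_univ, true_and]
    refine measurableSet_eq_fun ?_ measurable_const
    simp only [dotProduct, mulVec]
    fun_prop
  have hrej : MeasurableSet {p : PosDefPair ι |
      chiSqQuantile (rHat n A ρ (Matrix.of p.1.1) p.1.2)
        (1 - betaHat n A ρ (Matrix.of p.1.1) α p.1.2) < testStat n A ρ (Matrix.of p.1.1) p.1.2} := by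
    -- With the active set frozen at `J`, the chosen reference row no longer varies with the data.
    let β : Finset (Fin k) → PosDefPair ι → ℝ := fun J p =>
      if rowRank A J = 1 then
        if h : ∃ i, i ∈ J ∧ A i ≠ 0 then
          2 * α * stdNormalCDF (zInf n A ρ (Matrix.of p.1.1) p.1.2 h.choose)
        else α
      else α
    have hβ : ∀ J, Measurable (β J) := by
      intro J
      dsimp only [β]
      split_ifs
      · exact measurable_const.mul (stdNormalCDF_mono.measurable.comp (measurable_zInf hn hne _))
      · exact measurable_const
      · exact measurable_const
    have hβ0 : ∀ J p, 0 < β J p := by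
      intro J p
      dsimp only [β]
      split_ifs with h1 h2
      · have := half_le_stdNormalCDF (zInf_nonneg hn hne p.2 p.1.2 h2.choose)
        positivity
      · exact hα
      · exact hα
    have hβe : ∀ p : PosDefPair ι, betaHat n A ρ (Matrix.of p.1.1) α p.1.2 =
        β (activeSet n A ρ (Matrix.of p.1.1) p.1.2) p := fun p => rfl
    have : {p : PosDefPair ι | chiSqQuantile (rHat n A ρ (Matrix.of p.1.1) p.1.2)
        (1 - betaHat n A ρ (Matrix.of p.1.1) α p.1.2) < testStat n A ρ (Matrix.of p.1.1) p.1.2} =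
        ⋃ J, {p | activeSet n A ρ (Matrix.of p.1.1) p.1.2 = J} ∩
          {p | chiSqQuantile (rowRank A J) (1 - β J p) <
            testStat n A ρ (Matrix.of p.1.1) p.1.2} := by
      ext p
      simp only [Set.mem_ofPred_eq, Set.mem_iUnion, Set.mem_inter_iff, hβe, rHat]
      constructor
      · intro h
        exact ⟨_, rfl, h⟩
      · rintro ⟨J, rfl, h⟩
        exact h
    rw [this]
    refine MeasurableSet.iUnion fun J => (hact J).inter
      (measurableSet_chiSqQuantile_lt _ (measurable_const.sub (hβ J)) hT fun p => ?_)
    linarith [hβ0 J p]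
  exact Measurable.ite hrej measurable_const measurable_const

end Measurability

/-! ### Level for an exactly normal sample moment -/

section NormalMoment

open scoped ENNReal MatrixOrder

variable {k n : ℕ} {ι : Type*} [Fintype ι] [DecidableEq ι] {A : Matrix (Fin k) ι ℝ}
  {ρ : Fin k → ℝ} {S : Matrix ι ι ℝ} {α : ℝ}

lemma measurable_rccTest_right (hn : 0 < n) (hα : 0 < α) (hS : S.PosDef) :
    Measurable fun x : EuclideanSpace ℝ ι => rccTest n A ρ S α x.ofLp := by
  have h := measurable_rccTest (A := A) (ρ := ρ) hn hα
  exact h.comp (g := fun p : PosDefPair ι => rccTest n A ρ (Matrix.of p.1.1) α p.1.2)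
    (f := fun x : EuclideanSpace ℝ ι => (⟨(S, x.ofLp), hS⟩ : PosDefPair ι))
    (Measurable.subtype_mk (by fun_prop))

variable {μ : Measure (EuclideanSpace ℝ ι)} {m : EuclideanSpace ℝ ι}

lemma integral_rccTest_eq (hn : 0 < n) (hα : 0 < α) (hS : S.PosDef)
    (hμ : μ.map (fun x => Real.sqrt n • (x - m)) = multivariateGaussian 0 S)
    (hm : ∀ l, (A *ᵥ m.ofLp) l ≤ ρ l) :
    ∫ x, rccTest n A ρ S α x.ofLp ∂μ = (stdGaussian (EuclideanSpace ℝ ι)).real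
      (rej (stdRow A (CFC.sqrt S)) (stdRhs n A ρ m.ofLp) α) := by
  obtain ⟨hR, hRR, hdet⟩ := sqrt_posDef hS
  set R := CFC.sqrt S with hRdef
  have hs : Real.sqrt n ≠ 0 := (Real.sqrt_pos.2 (by exact_mod_cast hn)).ne'
  have hne : (poly (stdRow A R) (stdRhs n A ρ m.ofLp)).Nonempty :=
    ⟨0, fun l => by
      rw [inner_zero_right]
      exact mul_nonneg (Real.sqrt_nonneg _) (sub_nonneg.2 (hm l))⟩
  -- Undoing the normalization exhibits `μ` as the law of `m + n^{-1/2} R u` with `u` standard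
  -- Gaussian.
  have hμ' : μ = (stdGaussian (EuclideanSpace ℝ ι)).map
      (fun u => WithLp.toLp 2 (unstandardize n m.ofLp R u)) := by
    have h1 : μ = (μ.map (fun x => Real.sqrt n • (x - m))).map
        (fun y => m + (Real.sqrt n)⁻¹ • y) := by
      rw [Measure.map_map (by fun_prop) (by fun_prop)]
      conv_lhs => rw [← Measure.map_id (μ := μ)]
      congr 1
      ext x i
      simp [hs]
    rw [h1, hμ, multivariateGaussian, Measure.map_map (by fun_prop) (by fun_prop)]
    congr 1
    ext u i
    simp [unstandardize, ofLp_toEuclideanCLM, hRdef]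
  have hmu : Measurable fun u : EuclideanSpace ℝ ι =>
      (WithLp.toLp 2 (unstandardize n m.ofLp R u) : EuclideanSpace ℝ ι) := by
    have : Continuous fun u : EuclideanSpace ℝ ι =>
        (WithLp.toLp 2 (unstandardize n m.ofLp R u) : EuclideanSpace ℝ ι) := by
      unfold unstandardize
      fun_prop
    exact this.measurable
  rw [hμ', integral_map hmu.aemeasurable
    (measurable_rccTest_right hn hα hS).aestronglyMeasurable]
  simp only [rccTest_unstandardize hn hR hRR hdet hne]
  rw [integral_indicator_one (measurableSet_rej hne hα)]

theorem integral_rccTest_le (hn : 0 < n) (hα : 0 < α) (hα1 : α ≤ 1) (hS : S.PosDef)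
    (hμ : μ.map (fun x => Real.sqrt n • (x - m)) = multivariateGaussian 0 S)
    (hm : ∀ l, (A *ᵥ m.ofLp) l ≤ ρ l) :
    ∫ x, rccTest n A ρ S α x.ofLp ∂μ ≤ α := by
  rw [integral_rccTest_eq hn hα hS hμ hm, measureReal_def]
  refine ENNReal.toReal_le_of_le_ofReal hα.le (stdGaussian_rej_le (fun l => ?_) hα hα1)
  exact mul_nonneg (Real.sqrt_nonneg _) (sub_nonneg.2 (hm l))

theorem integral_rccTest_eq_level (hn : 0 < n) (hα : 0 < α) (hα1 : α ≤ 1 / 2) (hS : S.PosDef)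
    (hμ : μ.map (fun x => Real.sqrt n • (x - m)) = multivariateGaussian 0 S)
    (hA : A ≠ 0) (hm : A *ᵥ m.ofLp = ρ) :
    ∫ x, rccTest n A ρ S α x.ofLp ∂μ = α := by
  rw [integral_rccTest_eq hn hα hS hμ fun l => (congrFun hm l).le, measureReal_def,
    stdGaussian_rej_eq _ _ hα hα1, ENNReal.toReal_ofReal hα.le]
  · intro l
    rw [stdRhs, hm, sub_self, mul_zero]
  · by_contra hc
    push Not at hc
    refine hA (Matrix.ext fun l j => ?_)
    rw [(stdRow_eq_zero_iff (sqrt_posDef hS).2.2 l).1 (hc l)]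
    rfl

end NormalMoment

/-! ### The two-stage procedure -/

section TwoStage

variable {Ω 𝓦 Θ Δ : Type*} [MeasurableSpace Ω] [MeasurableSpace 𝓦] [MeasurableSpace Δ]
  {n k dM dN : ℕ}

lemma measurable_pbar {M : 𝓦 → Θ → EuclideanSpace ℝ (Fin dM)}
    {N : 𝓦 → Θ → Δ → EuclideanSpace ℝ (Fin dN)} {W : Fin n → Ω → 𝓦} {δhat : Ω → Δ} {θ : Θ}
    (hM : Measurable fun w => M w θ) (hN : Measurable fun q : 𝓦 × Δ => N q.1 θ q.2)
    (hW : ∀ i, Measurable (W i)) (hδ : Measurable δhat) : Measurable (pbar M N W δhat θ) := by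
  have h1 : ∀ i, Measurable fun ω => M (W i ω) θ := fun i => hM.comp (hW i)
  have h2 : ∀ i, Measurable fun ω => N (W i ω) θ (δhat ω) := fun i => hN.comp ((hW i).prodMk hδ)
  have h3 : ∀ i, Measurable fun ω => momentFun M N (W i ω) θ (δhat ω) := by
    intro i
    refine (WithLp.measurable_toLp 2 _).comp (measurable_pi_lambda _ fun a => ?_)
    cases a with
    | inl a => exact (EuclideanSpace.proj (𝕜 := ℝ) a).continuous.measurable.comp (h1 i)
    | inr a => exact (EuclideanSpace.proj (𝕜 := ℝ) a).continuous.measurable.comp (h2 i)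
  exact (Finset.measurable_sum _ fun i _ => h3 i).const_smul (n : ℝ)⁻¹

/-! ### A measurable version of the conditional variance -/

section Covariance

variable {ι : Type*} [Fintype ι] [DecidableEq ι]

/-- The covariance matrix of a normalized kernel. -/
def kernelCov (n : ℕ) (κ : Kernel Δ (EuclideanSpace ℝ ι)) (d : Δ) : ι → ι → ℝ := fun i j =>
  ∫ x, (Real.sqrt n • (x - ∫ y, y ∂(κ d))) i * (Real.sqrt n • (x - ∫ y, y ∂(κ d))) j ∂(κ d)

omit [DecidableEq ι] in
lemma measurable_kernelCov (n : ℕ) (κ : Kernel Δ (EuclideanSpace ℝ ι)) [IsSFiniteKernel κ] :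
    Measurable (kernelCov n κ) := by
  have hm : Measurable fun d => ∫ y, y ∂(κ d) := by
    have : StronglyMeasurable fun d => ∫ y, (fun p : Δ × EuclideanSpace ℝ ι => p.2) (d, y) ∂(κ d) :=
      StronglyMeasurable.integral_kernel_prod_right' measurable_snd.stronglyMeasurable
    exact this.measurable
  refine measurable_pi_lambda _ fun i => measurable_pi_lambda _ fun j => ?_
  have h : Measurable fun p : Δ × EuclideanSpace ℝ ι =>
      (Real.sqrt n • (p.2 - ∫ y, y ∂(κ p.1))) i * (Real.sqrt n • (p.2 - ∫ y, y ∂(κ p.1))) j := by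
    have h1 : Measurable fun p : Δ × EuclideanSpace ℝ ι => ∫ y, y ∂(κ p.1) :=
      hm.comp measurable_fst
    fun_prop
  exact (StronglyMeasurable.integral_kernel_prod_right' (κ := κ) h.stronglyMeasurable).measurable

/-- The normalized law has mean zero and covariance `S`, so `S` can be read off from the kernel,
which depends measurably on `d`. -/
lemma kernelCov_eq {κ : Kernel Δ (EuclideanSpace ℝ ι)} {d : Δ} {S : Matrix ι ι ℝ} (hS : S.PosDef)
    (h : (κ d).map (fun x => Real.sqrt n • (x - ∫ y, y ∂(κ d))) = multivariateGaussian 0 S) :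
    Matrix.of (kernelCov n κ d) = S := by
  ext i j
  have hmean : ∀ i, ∫ y : EuclideanSpace ℝ ι, y i ∂(multivariateGaussian 0 S) = 0 := by
    intro i
    have h1 := (EuclideanSpace.proj (𝕜 := ℝ) i).integral_comp_comm
      (IsGaussian.integrable_fun_id (μ := multivariateGaussian 0 S))
    rw [integral_id_multivariateGaussian] at h1
    simpa using h1
  have h2 := covariance_eval_multivariateGaussian (μ := 0) hS.posSemidef i j
  rw [covariance] at h2
  simp only [hmean, sub_zero] at h2
  rw [Matrix.of_apply, kernelCov, ← h2, ← h, integral_map (by fun_prop)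
    (Measurable.aestronglyMeasurable (by fun_prop))]

end Covariance

lemma rccTest_nonneg {ι : Type*} [Fintype ι] [DecidableEq ι] (A : Matrix (Fin k) ι ℝ)
    (ρ : Fin k → ℝ) (S : Matrix ι ι ℝ) (α : ℝ) (x : ι → ℝ) : 0 ≤ rccTest n A ρ S α x := by
  rw [rccTest]
  split_ifs <;> simp

lemma rccTest_le_one {ι : Type*} [Fintype ι] [DecidableEq ι] (A : Matrix (Fin k) ι ℝ)
    (ρ : Fin k → ℝ) (S : Matrix ι ι ℝ) (α : ℝ) (x : ι → ℝ) : rccTest n A ρ S α x ≤ 1 := by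
  rw [rccTest]
  split_ifs <;> simp

omit [MeasurableSpace 𝓦] in
open Classical in
/-- The test is integrable and its conditional expectation is obtained by integrating it against
the conditional distribution of the sample moment. -/
lemma integrable_phiRCC_and_condExp {P : Measure Ω} [IsProbabilityMeasure P] (hn : 0 < n)
    {M : 𝓦 → Θ → EuclideanSpace ℝ (Fin dM)} {N : 𝓦 → Θ → Δ → EuclideanSpace ℝ (Fin dN)}
    (B : Θ → Matrix (Fin k) (Fin dM) ℝ) (C : Θ → Matrix (Fin k) (Fin dN) ℝ) (ρ : Θ → Fin k → ℝ)
    {W : Fin n → Ω → 𝓦} {δhat : Ω → Δ} (hδ : Measurable δhat)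
    {Sigma : Θ → Δ → Matrix (Fin dM ⊕ Fin dN) (Fin dM ⊕ Fin dN) ℝ}
    {Sigmahat : Θ → Δ → Ω → Matrix (Fin dM ⊕ Fin dN) (Fin dM ⊕ Fin dN) ℝ}
    {α : ℝ} (hα : 0 < α) {θ : Θ} (hY : Measurable (pbar M N W δhat θ))
    (hGauss : ∀ᵐ d ∂(P.map δhat), (Sigma θ d).PosDef ∧
      (condDistrib (pbar M N W δhat θ) δhat P d).map
        (fun x => Real.sqrt n • (x - condMean P M N W δhat θ d)) =
      multivariateGaussian 0 (Sigma θ d))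
    (hSigma : ∀ᵐ ω ∂P, Sigmahat θ (δhat ω) ω = Sigma θ (δhat ω)) :
    Integrable (phiRCC B C ρ M N W δhat Sigmahat α θ) P ∧
      P[phiRCC B C ρ M N W δhat Sigmahat α θ | MeasurableSpace.comap δhat inferInstance] =ᵐ[P]
        fun ω => ∫ x, rccTest n (constraintMatrix B C θ) (ρ θ) (Sigma θ (δhat ω)) α x.ofLp
          ∂(condDistrib (pbar M N W δhat θ) δhat P (δhat ω)) := by
  set κ := condDistrib (pbar M N W δhat θ) δhat P with hκ
  -- No measurability of `Sigma` or `Sigmahat` in `d` is available, so they are replaced by the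
  -- covariance of the conditional law. The identity on the exceptional set is an arbitrary choice
  -- that keeps `V` positive definite everywhere.
  let V : Δ → (Fin dM ⊕ Fin dN) → (Fin dM ⊕ Fin dN) → ℝ := fun d =>
    if (Matrix.of (kernelCov n κ d)).PosDef then kernelCov n κ d else
      Matrix.of.symm (1 : Matrix (Fin dM ⊕ Fin dN) (Fin dM ⊕ Fin dN) ℝ)
  have hVpos : ∀ d, (Matrix.of (V d)).PosDef := by
    intro d
    dsimp only [V]
    split_ifs with h
    · exact h
    · exact Matrix.PosDef.one
  have hVm : Measurable V := Measurable.ite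
    (measurable_kernelCov n κ measurableSet_posDef) (measurable_kernelCov n κ) measurable_const
  have hV : ∀ᵐ d ∂(P.map δhat), Matrix.of (V d) = Sigma θ d := by
    filter_upwards [hGauss] with d hd
    have h1 := kernelCov_eq hd.1 hd.2
    have h2 : (Matrix.of (kernelCov n κ d)).PosDef := by rw [h1]; exact hd.1
    dsimp only [V]
    rw [if_pos h2, h1]
  let F : Δ × EuclideanSpace ℝ (Fin dM ⊕ Fin dN) → ℝ := fun p =>
    rccTest n (constraintMatrix B C θ) (ρ θ) (Matrix.of (V p.1)) α p.2.ofLp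
  have hF : Measurable F := by
    have h := measurable_rccTest (A := constraintMatrix B C θ) (ρ := ρ θ) hn hα
    exact h.comp (g := fun p : PosDefPair (Fin dM ⊕ Fin dN) =>
        rccTest n (constraintMatrix B C θ) (ρ θ) (Matrix.of p.1.1) α p.1.2)
      (f := fun p : Δ × EuclideanSpace ℝ (Fin dM ⊕ Fin dN) =>
        (⟨(V p.1, p.2.ofLp), hVpos p.1⟩ : PosDefPair (Fin dM ⊕ Fin dN)))
      (Measurable.subtype_mk (by fun_prop))
  have hphi : phiRCC B C ρ M N W δhat Sigmahat α θ =ᵐ[P]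
      fun ω => F (δhat ω, pbar M N W δhat θ ω) := by
    filter_upwards [hSigma, ae_of_ae_map hδ.aemeasurable hV] with ω h1 h2
    rw [phiRCC, h1, ← h2]
  have hint : Integrable (fun ω => F (δhat ω, pbar M N W δhat θ ω)) P := by
    refine Integrable.of_bound (hF.comp (hδ.prodMk hY)).aestronglyMeasurable 1
      (Filter.Eventually.of_forall fun ω => ?_)
    rw [Real.norm_of_nonneg (rccTest_nonneg _ _ _ _ _)]
    exact rccTest_le_one _ _ _ _ _
  refine ⟨hint.congr hphi.symm, ?_⟩
  refine (condExp_congr_ae hphi).trans ?_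
  refine (condExp_prod_ae_eq_integral_condDistrib hδ hY.aemeasurable hF.stronglyMeasurable
    hint).trans ?_
  filter_upwards [ae_of_ae_map hδ.aemeasurable hV] with ω h2
  rw [← h2]

end TwoStage

end RCC

end

theorem mainTheorem2
    {Ω : Type*} [MeasurableSpace Ω] (P : Measure Ω) [IsProbabilityMeasure P]
    {𝓦 : Type*} [MeasurableSpace 𝓦] {Θ : Type*} {Δ : Type*} [MeasurableSpace Δ]
    {n k dM dN : ℕ} (hn : 0 < n)
    -- the moment functions, the coefficients, the sample and the first-stage estimator
    (M : 𝓦 → Θ → EuclideanSpace ℝ (Fin dM))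
    (hM : ∀ θ, Measurable fun w => M w θ)
    (N : 𝓦 → Θ → Δ → EuclideanSpace ℝ (Fin dN))
    (hN : ∀ θ, Measurable fun q : 𝓦 × Δ => N q.1 θ q.2)
    (B : Θ → Matrix (Fin k) (Fin dM) ℝ) (C : Θ → Matrix (Fin k) (Fin dN) ℝ)
    (ρ : Θ → Fin k → ℝ)
    (W : Fin n → Ω → 𝓦) (hW : ∀ i, Measurable (W i))
    (δhat : Ω → Δ) (hδ : Measurable δhat)
    -- the conditional variance and its estimator
    (Sigma : Θ → Δ → Matrix (Fin dM ⊕ Fin dN) (Fin dM ⊕ Fin dN) ℝ)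
    (Sigmahat : Θ → Δ → Ω → Matrix (Fin dM ⊕ Fin dN) (Fin dM ⊕ Fin dN) ℝ)
    (α : ℝ) (hα0 : 0 < α) (hα1 : α < 1)
    -- conditionally on `δ̂`, the normalized centered moment is exactly normal
    (hGauss : ∀ θ, ∀ᵐ d ∂(P.map δhat), (Sigma θ d).PosDef ∧
      (condDistrib (RCC.pbar M N W δhat θ) δhat P d).map
        (fun x => Real.sqrt n • (x - RCC.condMean P M N W δhat θ d)) =
      multivariateGaussian 0 (Sigma θ d))
    -- the variance is known exactly
    (hSigma : ∀ θ, ∀ᵐ ω ∂P, Sigmahat θ (δhat ω) ω = Sigma θ (δhat ω)) :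
    ∀ θ,
      Integrable (RCC.phiRCC B C ρ M N W δhat Sigmahat α θ) P ∧
      (∀ᵐ ω ∂P,
        (∀ l, (RCC.constraintMatrix B C θ *ᵥ (RCC.condMean P M N W δhat θ (δhat ω)).ofLp) l
          ≤ ρ θ l) →
        (P[RCC.phiRCC B C ρ M N W δhat Sigmahat α θ |
          MeasurableSpace.comap δhat inferInstance]) ω ≤ α) ∧
      (α ≤ 1 / 2 → RCC.constraintMatrix B C θ ≠ 0 →
        ∀ᵐ ω ∂P,
          RCC.constraintMatrix B C θ *ᵥ (RCC.condMean P M N W δhat θ (δhat ω)).ofLp = ρ θ →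
          (P[RCC.phiRCC B C ρ M N W δhat Sigmahat α θ |
            MeasurableSpace.comap δhat inferInstance]) ω = α) := by
  intro θ
  have hY := RCC.measurable_pbar (hM θ) (hN θ) hW hδ
  obtain ⟨h1, h2⟩ := RCC.integrable_phiRCC_and_condExp hn B C ρ hδ hα0 hY (hGauss θ) (hSigma θ)
  have hG := ae_of_ae_map hδ.aemeasurable (hGauss θ)
  refine ⟨h1, ?_, fun hα2 hA => ?_⟩
  -- The moment inequalities enter only at the given `ω`; the exceptional null set does not depend
  -- on them.
  · filter_upwards [h2, hG] with ω hω hd hm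
    rw [hω]
    exact RCC.integral_rccTest_le hn hα0 hα1.le hd.1 hd.2 hm
  · filter_upwards [h2, hG] with ω hω hd hm
    rw [hω]
    exact RCC.integral_rccTest_eq_level hn hα0 hα2 hd.1 hd.2 hA hm
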